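/- Let $\mathbb{F}_q$ be a finite field of characteristic $\ell$, let $\psi(a)=\exp(2\pi \mathrm{i}\,\mathrm{Tr}_{\mathbb{F}_q/\mathbb{F}_\ell}(a)/\ell)$ be its standard additive character, and let $\epsilon:\mathbb{F}_q^{n}\to\mathbb{C}^{n}$ be the map that applies $\psi$ to each coordinate. For each $i\ge 1$ let $\mathcal{C}_i\subseteq\mathbb{F}_q^{n_i}$ be a linear code with $N_i=|\mathcal{C}_i|$ codewords, and let $p_i$ be a positive integer. Assume that (i) $N_i/n_i\to\infty$ as $i\to\infty$; (ii) for each $i$ the dual distance of $\mathcal{C}_i$ is at least $5$, that is, every nonzero word of the dual code $\mathcal{C}_i^{\perp}$ has Hamming weight at least $5$; (iii) there is a constant $c>0$, independent of $i$, such that $|\langle v,v'\rangle|\le c\sqrt{n_i}$ for all $v\ne v'$ in $\epsilon(\mathcal{C}_i)$, where $\langle\cdot,\cdot\rangle$ is the standard inner product on $\mathbb{C}^{n_i}$. Choose $p_i$ distinct codewords of $\mathcal{C}_i$ uniformly at random (which is possible for all large $i$ under the assumptions made here), let $\Phi_i$ be the $p_i\times n_i$ matrix whose rows are their images under $\epsilon$,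 let $G_i=\frac{1}{n_i}\Phi_i\Phi_i^{*}$, and let $\widetilde{M}_i(x)$ be the empirical spectral distribution of the Hermitian matrix $\sqrt{n_i/p_i}\,(G_i-I_{p_i})$, that is, the proportion of its $p_i$ eigenvalues (counted with multiplicity) that are at most $x$. Let $M_{\mathrm{SC}}(x)=\int_{-\infty}^{x}\frac{1}{2\pi}\sqrt{4-t^2}\,\mathbf{1}_{[-2,2]}(t)\,dt$ be the distribution function of Wigner's semicircle law. If $n_i$, $p_i$ and $n_i/p_i$ all tend to infinity as $i\to\infty$, then for every $x\in\mathbb{R}$ we have $\widetilde{M}_i(x)\to M_{\mathrm{SC}}(x)$ in probability, that is, for every $\delta>0$, $$\mathbb{P}\left(|\widetilde{M}_i(x)-M_{\mathrm{SC}}(x)|\ge\delta\right)\to 0\quad\text{as } i\to\infty.$$ -/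

import Mathlib

open Filter Topology MeasureTheory
open scoped Matrix ENNReal

noncomputable section

namespace CodeSC

/-- The dual code `C^⊥`, for the standard bilinear form `∑ⱼ uⱼ cⱼ` on `F ^ n`. -/
def dualCode {F : Type*} [Field F] {n : ℕ} (C : Submodule F (Fin n → F)) :
    Submodule F (Fin n → F) where
  carrier := {u | ∀ c ∈ C, u ⬝ᵥ c = 0}
  add_mem' := by
    intro a b ha hb c hc
    rw [add_dotProduct, ha c hc, hb c hc, add_zero]
  zero_mem' := by
    intro c _
    exact zero_dotProduct c
  smul_mem' := by
    intro r a ha c hc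
    rw [smul_dotProduct, ha c hc, smul_zero]

open Classical in
/-- The dual distance of `C`: the minimum Hamming weight of a nonzero word of the dual code
(`⊤` if the dual code has no nonzero word). -/
def dualDistance {F : Type*} [Field F] {n : ℕ} (C : Submodule F (Fin n → F)) : ℕ∞ :=
  ⨅ u ∈ {u : Fin n → F | u ∈ dualCode C ∧ u ≠ 0}, (hammingNorm u : ℕ∞)

instance neZero_ringChar (F : Type*) [Field F] [Finite F] : NeZero (ringChar F) :=
  ⟨CharP.char_ne_zero_of_finite F (ringChar F)⟩

/-- The standard additive character `a ↦ exp (2 π i Tr(a) / ℓ)` of a finite field of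
characteristic `ℓ`, where `Tr` is the trace to the prime field `ZMod ℓ`. -/
def stdChar (F : Type*) [Field F] [Finite F] : AddChar F ℂ :=
  letI : Algebra (ZMod (ringChar F)) F := ZMod.algebra F (ringChar F)
  (ZMod.stdAddChar (N := ringChar F)).compAddMonoidHom
    (Algebra.trace (ZMod (ringChar F)) F).toAddMonoidHom

/-- The componentwise extension `ε : F ^ n → ℂ ^ n` of the standard additive character. -/
def eps {F : Type*} [Field F] [Finite F] {n : ℕ} (u : Fin n → F) : Fin n → ℂ :=
  fun j => stdChar F (u j)

/-- The `p × n` matrix whose rows are `ε (s 1), …, ε (s p)`, for distinct codewords `s 1, …, s p`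
of `C`. -/
def codeMatrix {F : Type*} [Field F] [Finite F] {n : ℕ} {C : Submodule F (Fin n → F)} {p : ℕ}
    (s : Fin p ↪ C) : Matrix (Fin p) (Fin n) ℂ :=
  Matrix.of fun a => eps (s a : Fin n → F)

/-- The Gram matrix `G = (1 / n) Φ Φ*` of `Φ / √n`. -/
def gram {F : Type*} [Field F] [Finite F] {n : ℕ} {C : Submodule F (Fin n → F)} {p : ℕ}
    (s : Fin p ↪ C) : Matrix (Fin p) (Fin p) ℂ :=
  (1 / (n : ℂ)) • (codeMatrix s * (codeMatrix s)ᴴ)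

/-- The matrix `√(n / p) (G - I)`. -/
def normalizedGram {F : Type*} [Field F] [Finite F] {n : ℕ} {C : Submodule F (Fin n → F)} {p : ℕ}
    (s : Fin p ↪ C) : Matrix (Fin p) (Fin p) ℂ :=
  ((Real.sqrt ((n : ℝ) / (p : ℝ)) : ℝ) : ℂ) • (gram s - 1)

lemma normalizedGram_isHermitian {F : Type*} [Field F] [Finite F] {n : ℕ}
    {C : Submodule F (Fin n → F)} {p : ℕ} (s : Fin p ↪ C) : (normalizedGram s).IsHermitian := by
  simp [Matrix.IsHermitian, normalizedGram, gram, Matrix.conjTranspose_smul,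
    Matrix.conjTranspose_sub, Matrix.conjTranspose_mul]

/-- The spectral measure `(1 / p) ∑ⱼ δ_{λⱼ}` of a Hermitian `p × p` matrix with eigenvalues
`λ₁, …, λₚ` (with multiplicity). -/
def spectralMeasure {p : ℕ} {A : Matrix (Fin p) (Fin p) ℂ} (hA : A.IsHermitian) : Measure ℝ :=
  (p : ℝ≥0∞)⁻¹ • ∑ j, Measure.dirac (hA.eigenvalues j)

/-- The empirical spectral distribution: the distribution function of the spectral measure. -/
def empiricalSpectralDistribution {p : ℕ} {A : Matrix (Fin p) (Fin p) ℂ} (hA : A.IsHermitian)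
    (x : ℝ) : ℝ :=
  (spectralMeasure hA).real (Set.Iic x)

/-- The density of Wigner's semicircle law. -/
def semicircleDensity : ℝ → ℝ :=
  (Set.Icc (-2) 2).indicator fun x => 1 / (2 * Real.pi) * Real.sqrt (4 - x ^ 2)

/-- Wigner's semicircle law, as a measure on the line. -/
def semicircleLaw : Measure ℝ :=
  volume.withDensity fun x => ENNReal.ofReal (semicircleDensity x)

/-- The distribution function of Wigner's semicircle law. -/
def semicircleCDF (x : ℝ) : ℝ := semicircleLaw.real (Set.Iic x)

/-- Uniformly random choice of `p` distinct codewords of `C` (in order): the uniform probability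
measure on the finite set of injections from `{1, …, p}` to `C`, all of whose subsets are
measurable. -/
def distinctCodewordsMeasure {F : Type*} [Field F] [Finite F] {n : ℕ}
    (C : Submodule F (Fin n → F)) (p : ℕ) : @Measure (Fin p ↪ C) ⊤ :=
  @ProbabilityTheory.uniformOn (Fin p ↪ C) ⊤ Set.univ

end CodeSC

end

/-!
Write `M` for the matrix `√(n/p) (G - I)`. Its diagonal vanishes and its off-diagonal entries are
the inner products of the rows divided by `√(p n)`. A code of dual distance at least five maps
onto `F ^ 4` under any four coordinates, so a uniformly random codeword, after applying the
character, is a vector `X` of unimodular coordinates whose products `X j * conj (X k)`, `j ≠ k`,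
are orthogonal up to exchanging `j` and `k` (`FourwiseOrthogonal`, `fourwiseOrthogonal_eps`). Hence every quadratic
form `Xᵀ B X̄` has mean `tr B` and variance at most `2 ‖B‖²` in the Frobenius norm
(`FourwiseOrthogonal.expect_norm_quadForm_sub_sq_le`).

Take first independent uniformly random codewords as rows. Let `R = (M - z)⁻¹` with `Im z > 0` and
`m = (1/p) tr R`. Schur's complement formula (`one_add_resolvent_apply_mul`) writes `- 1 / R a a` as
`z` plus a quadratic form in row `a`, whose matrix depends only on the other rows. Its trace is
`m` up to `O(1/p + √(p/n))` and its Frobenius norm is `O(1/√p)`, so `m² + z m + 1 → 0` in mean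
(`expect_norm_stieltjes_sq_add_le`). For `z = u + i v` this forces `Im m` to be close to `π` times
the semicircle density at `u`, once `v` is small (`sq_im_sub_le_of_im`). Integrated over `u`, this
says that the spectrum smoothed by the Poisson kernel of width `v` has nearly the semicircle
density, and sandwiching gives convergence in mean of the distribution function at every point
(`abs_expect_sub_semicircleCDF_le`, `expect_abs_sub_semicircleCDF_le`).

Finally, the variance bound for the all-ones matrix shows that the code has at least `(n - 1)² / 2`
codewords (`sq_le_two_mul_card`). As `p / n → 0`, at least half of all `p`-tuples of codewords are
injective in the end, so passing to distinct codewords costs a factor two in Markov's inequality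
(`distinctCodewordsMeasure_le`).
-/

noncomputable section

namespace CodeSC

open scoped BigOperators

/-! ### Resolvents of Hermitian matrices -/

section Resolvent

variable {ι : Type*} [Fintype ι]

/-- The Euclidean norm of a complex vector given as a plain function, whose own norm in Mathlib
is the supremum norm. -/
def euclNorm (x : ι → ℂ) : ℝ := ‖WithLp.toLp 2 x‖

lemma euclNorm_nonneg (x : ι → ℂ) : 0 ≤ euclNorm x := norm_nonneg _

lemma euclNorm_sq (x : ι → ℂ) : euclNorm x ^ 2 = ∑ i, ‖x i‖ ^ 2 := by
  simp [euclNorm, EuclideanSpace.norm_sq_eq]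

lemma norm_le_euclNorm (x : ι → ℂ) (i : ι) : ‖x i‖ ≤ euclNorm x :=
  PiLp.norm_apply_le (WithLp.toLp 2 x) i

lemma star_dotProduct_self (x : ι → ℂ) : star x ⬝ᵥ x = ((euclNorm x ^ 2 : ℝ) : ℂ) := by
  rw [euclNorm_sq, dotProduct]
  push_cast
  refine Finset.sum_congr rfl fun i _ => ?_
  rw [Pi.star_apply, ← Complex.ofReal_pow, ← Complex.normSq_eq_norm_sq,
    Complex.normSq_eq_conj_mul_self]
  rfl

lemma norm_star_dotProduct_le (x y : ι → ℂ) : ‖star x ⬝ᵥ y‖ ≤ euclNorm x * euclNorm y := by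
  have := norm_inner_le_norm (𝕜 := ℂ) (WithLp.toLp 2 x) (WithLp.toLp 2 y)
  rw [EuclideanSpace.inner_eq_star_dotProduct, dotProduct_comm] at this
  exact this

variable [DecidableEq ι]

lemma euclNorm_single_one (a : ι) : euclNorm (Pi.single a (1 : ℂ)) = 1 := by
  simp [euclNorm]

/-- The resolvent `(A - z)⁻¹` of a square matrix. The inverse is Mathlib's total one, but `A` is
Hermitian and `z` is not real wherever the resolvent is used. -/
def resolvent (A : Matrix ι ι ℂ) (z : ℂ) : Matrix ι ι ℂ := (A - z • 1)⁻¹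

variable {A : Matrix ι ι ℂ} {z : ℂ}

/-- The imaginary part of `x* (A - z) x` is `- (Im z) ‖x‖²`, so `A - z` is bounded below. -/
lemma abs_im_mul_euclNorm_le (hA : A.IsHermitian) (x : ι → ℂ) :
    |z.im| * euclNorm x ≤ euclNorm ((A - z • 1) *ᵥ x) := by
  have h1 : (star x ⬝ᵥ ((A - z • 1) *ᵥ x)).im = - (z.im * euclNorm x ^ 2) := by
    have h2 : (star x ⬝ᵥ (A *ᵥ x)).im = 0 := hA.im_star_dotProduct_mulVec_self x
    rw [Matrix.sub_mulVec, dotProduct_sub, Complex.sub_im, h2, Matrix.smul_mulVec,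
      Matrix.one_mulVec, dotProduct_smul, star_dotProduct_self, smul_eq_mul, Complex.im_mul_ofReal]
    ring
  have h3 : |z.im| * euclNorm x ^ 2 ≤ euclNorm x * euclNorm ((A - z • 1) *ᵥ x) := by
    calc |z.im| * euclNorm x ^ 2 = |(star x ⬝ᵥ ((A - z • 1) *ᵥ x)).im| := by
          rw [h1, abs_neg, abs_mul, abs_of_nonneg (sq_nonneg (euclNorm x))]
      _ ≤ _ := (Complex.abs_im_le_norm _).trans (norm_star_dotProduct_le _ _)
  rcases (euclNorm_nonneg x).eq_or_lt with h0 | h0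
  · rw [← h0, mul_zero]; exact euclNorm_nonneg _
  · nlinarith

lemma isUnit_sub_smul_one (hA : A.IsHermitian) (hz : z.im ≠ 0) :
    IsUnit (A - z • (1 : Matrix ι ι ℂ)) := by
  rw [← Matrix.mulVec_injective_iff_isUnit]
  intro x y hxy
  have h : (A - z • 1) *ᵥ (x - y) = 0 := by rw [Matrix.mulVec_sub]; exact sub_eq_zero.2 hxy
  have h1 := abs_im_mul_euclNorm_le (z := z) hA (x - y)
  have h0 : euclNorm (0 : ι → ℂ) = 0 := by simp [euclNorm]
  rw [h, h0] at h1
  have h2 : euclNorm (x - y) = 0 := by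
    have := abs_pos.2 hz
    have := euclNorm_nonneg (x - y)
    nlinarith
  ext i
  have := norm_le_euclNorm (x - y) i
  rw [h2] at this
  simpa [sub_eq_zero] using this

lemma sub_mul_resolvent (hA : A.IsHermitian) (hz : z.im ≠ 0) :
    (A - z • 1) * resolvent A z = 1 :=
  Matrix.mul_nonsing_inv _ ((Matrix.isUnit_iff_isUnit_det _).1 (isUnit_sub_smul_one hA hz))

lemma resolvent_mul_sub (hA : A.IsHermitian) (hz : z.im ≠ 0) :
    resolvent A z * (A - z • 1) = 1 :=
  Matrix.nonsing_inv_mul _ ((Matrix.isUnit_iff_isUnit_det _).1 (isUnit_sub_smul_one hA hz))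

lemma resolvent_mul (hA : A.IsHermitian) (hz : z.im ≠ 0) :
    resolvent A z * A = 1 + z • resolvent A z := by
  have := resolvent_mul_sub hA hz
  rw [mul_sub, mul_smul_comm, mul_one, sub_eq_iff_eq_add] at this
  exact this

lemma conjTranspose_resolvent (hA : A.IsHermitian) :
    (resolvent A z)ᴴ = resolvent A (star z) := by
  rw [resolvent, resolvent, Matrix.conjTranspose_nonsing_inv, Matrix.conjTranspose_sub, hA.eq,
    Matrix.conjTranspose_smul, Matrix.conjTranspose_one]

lemma euclNorm_resolvent_mulVec_le (hA : A.IsHermitian) (hz : z.im ≠ 0) (x : ι → ℂ) :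
    euclNorm (resolvent A z *ᵥ x) ≤ euclNorm x / |z.im| := by
  rw [le_div_iff₀ (abs_pos.2 hz), mul_comm]
  have := abs_im_mul_euclNorm_le (z := z) hA (resolvent A z *ᵥ x)
  rwa [Matrix.mulVec_mulVec, sub_mul_resolvent hA hz, Matrix.one_mulVec] at this

lemma euclNorm_col_resolvent_le (hA : A.IsHermitian) (hz : z.im ≠ 0) (a : ι) :
    euclNorm ((resolvent A z).col a) ≤ 1 / |z.im| := by
  have := euclNorm_resolvent_mulVec_le hA hz (Pi.single a 1)
  rwa [Matrix.mulVec_single_one, euclNorm_single_one] at this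

lemma norm_resolvent_apply_le (hA : A.IsHermitian) (hz : z.im ≠ 0) (a b : ι) :
    ‖resolvent A z a b‖ ≤ 1 / |z.im| :=
  (norm_le_euclNorm ((resolvent A z).col b) a).trans (euclNorm_col_resolvent_le hA hz b)

lemma sum_norm_sq_resolvent_le (hA : A.IsHermitian) (hz : z.im ≠ 0) :
    ∑ a, ∑ b, ‖resolvent A z a b‖ ^ 2 ≤ Fintype.card ι / |z.im| ^ 2 := by
  rw [Finset.sum_comm]
  calc ∑ b, ∑ a, ‖resolvent A z a b‖ ^ 2 ≤ ∑ _b : ι, (1 / |z.im|) ^ 2 := by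
        refine Finset.sum_le_sum fun b _ => ?_
        refine (euclNorm_sq ((resolvent A z).col b)).symm.trans_le ?_
        exact pow_le_pow_left₀ (euclNorm_nonneg _) (euclNorm_col_resolvent_le hA hz b) 2
    _ = _ := by simp [div_eq_mul_inv]

lemma norm_trace_resolvent_le (hA : A.IsHermitian) (hz : z.im ≠ 0) :
    ‖(resolvent A z).trace‖ ≤ Fintype.card ι / |z.im| := by
  calc ‖(resolvent A z).trace‖ ≤ ∑ _a : ι, 1 / |z.im| :=
        norm_sum_le_of_le _ fun a _ => norm_resolvent_apply_le hA hz a a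
    _ = _ := by simp [div_eq_mul_inv]

/-- The trace of the resolvent as the Stieltjes transform of the spectrum. -/
lemma trace_resolvent (hA : A.IsHermitian) (hz : z.im ≠ 0) :
    (resolvent A z).trace = ∑ j, ((hA.eigenvalues j : ℂ) - z)⁻¹ := by
  set U : Matrix ι ι ℂ := (hA.eigenvectorUnitary : Matrix ι ι ℂ) with hU
  have hUU : star U * U = 1 := Unitary.coe_star_mul_self hA.eigenvectorUnitary
  have hUU' : U * star U = 1 := Unitary.coe_mul_star_self hA.eigenvectorUnitary
  have hne : ∀ j, (hA.eigenvalues j : ℂ) - z ≠ 0 := by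
    intro j h
    have := congrArg Complex.im h
    simp only [Complex.sub_im, Complex.ofReal_im, zero_sub, Complex.zero_im, neg_eq_zero] at this
    exact hz this
  have hspec : A = U * Matrix.diagonal (fun j => (hA.eigenvalues j : ℂ)) * star U := by
    have := hA.spectral_theorem
    rw [Unitary.conjStarAlgAut_apply] at this
    exact this
  have hsub : A - z • 1 = U * Matrix.diagonal (fun j => (hA.eigenvalues j : ℂ) - z) * star U := by
    have : Matrix.diagonal (fun j => (hA.eigenvalues j : ℂ) - z)
        = Matrix.diagonal (fun j => (hA.eigenvalues j : ℂ)) - z • (1 : Matrix ι ι ℂ) := by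
      rw [Matrix.smul_one_eq_diagonal, Matrix.diagonal_sub]
    rw [this, mul_sub, sub_mul, ← hspec, mul_smul_comm, mul_one, smul_mul_assoc, hUU']
  have hres : resolvent A z
      = U * Matrix.diagonal (fun j => ((hA.eigenvalues j : ℂ) - z)⁻¹) * star U := by
    refine Matrix.inv_eq_right_inv ?_
    have hd : Matrix.diagonal (fun j => (hA.eigenvalues j : ℂ) - z)
        * Matrix.diagonal (fun j => ((hA.eigenvalues j : ℂ) - z)⁻¹) = 1 := by
      rw [Matrix.diagonal_mul_diagonal, ← Matrix.diagonal_one]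
      congr 1
      ext j
      exact mul_inv_cancel₀ (hne j)
    rw [hsub]
    calc _ = U * (Matrix.diagonal (fun j => (hA.eigenvalues j : ℂ) - z) * (star U * U)
          * Matrix.diagonal (fun j => ((hA.eigenvalues j : ℂ) - z)⁻¹)) * star U := by
          simp only [mul_assoc]
      _ = 1 := by rw [hUU, mul_one, hd, mul_one, hUU']
  rw [hres, Matrix.trace_mul_comm, ← mul_assoc, hUU, one_mul, Matrix.trace_diagonal]

/-! ### Removing one row and column -/

variable {A' : Matrix ι ι ℂ} {a : ι}

/-- The matrix `e_a w* + w e_a*`, which puts the vector `w` into column `a` and `w*` into row `a`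
of a matrix whose row and column `a` vanish. -/
def cross (a : ι) (w : ι → ℂ) : Matrix ι ι ℂ :=
  Matrix.vecMulVec (Pi.single a 1) (star w) + Matrix.vecMulVec w (Pi.single a 1)

lemma resolvent_mulVec_apply_eq_zero (hA' : A'.IsHermitian) (hz : z.im ≠ 0)
    (hrow : ∀ b, A' a b = 0) {w : ι → ℂ} (hw : w a = 0) : (resolvent A' z *ᵥ w) a = 0 := by
  have h : ((A' - z • 1) *ᵥ (resolvent A' z *ᵥ w)) a = w a := by
    rw [Matrix.mulVec_mulVec, sub_mul_resolvent hA' hz, Matrix.one_mulVec]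
  rw [Matrix.sub_mulVec, Pi.sub_apply, Matrix.smul_mulVec, Matrix.one_mulVec, Pi.smul_apply,
    hw, Matrix.mulVec, dotProduct] at h
  simp only [hrow, zero_mul, Finset.sum_const_zero, zero_sub, neg_eq_zero, smul_eq_mul,
    mul_eq_zero] at h
  refine h.resolve_left ?_
  rintro rfl
  simp at hz

/-- Schur's complement formula for a diagonal entry of the resolvent, when the diagonal entry of
the matrix is zero. -/
lemma one_add_resolvent_apply_mul (hA : A.IsHermitian) (hA' : A'.IsHermitian) (hz : z.im ≠ 0)
    (hrow : ∀ b, A' a b = 0) {w : ι → ℂ} (hw : w a = 0) (h : A = A' + cross a w) :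
    1 + resolvent A z a a * (z + star w ⬝ᵥ (resolvent A' z *ᵥ w)) = 0 := by
  have hA'e : A' *ᵥ Pi.single a 1 = 0 := by
    rw [Matrix.mulVec_single_one]
    ext b
    rw [Matrix.col_apply, ← hA'.apply, hrow, star_zero, Pi.zero_apply]
  set y := resolvent A' z *ᵥ w with hy
  have hya : y a = 0 := resolvent_mulVec_apply_eq_zero hA' hz hrow hw
  have hAy : (A - z • 1) *ᵥ (Pi.single a 1 - y)
      = -(z + star w ⬝ᵥ y) • (Pi.single a 1 : ι → ℂ) := by
    have h1 : (A' - z • 1) *ᵥ y = w := by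
      rw [hy, Matrix.mulVec_mulVec, sub_mul_resolvent hA' hz, Matrix.one_mulVec]
    have h2 : cross a w *ᵥ y = (star w ⬝ᵥ y) • (Pi.single a 1 : ι → ℂ) := by
      ext b
      simp [cross, Matrix.add_mulVec, Matrix.vecMulVec_mulVec, hya, mul_comm]
    have h3 : cross a w *ᵥ (Pi.single a 1) = w := by
      ext b
      simp [cross, Matrix.vecMulVec_apply, hw]
    have h4 : A - z • 1 = (A' - z • 1) + cross a w := by rw [h]; abel
    rw [Matrix.mulVec_sub, h4, Matrix.add_mulVec, Matrix.add_mulVec, h1, h2, h3, Matrix.sub_mulVec,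
      hA'e, Matrix.smul_mulVec, Matrix.one_mulVec, neg_smul, add_smul]
    abel
  have h5 := congrArg (fun x => (resolvent A z *ᵥ x) a) hAy
  simp only [Matrix.mulVec_mulVec, resolvent_mul_sub hA hz, Matrix.one_mulVec, Matrix.mulVec_smul,
    Matrix.mulVec_single_one, Pi.sub_apply, Pi.single_eq_same, hya, Pi.smul_apply,
    Matrix.col_apply, smul_eq_mul] at h5
  linear_combination h5

/-- Removing one row and column hardly changes the trace of the resolvent: the difference of the
matrices has rank two. -/
lemma norm_trace_resolvent_sub_le (hA : A.IsHermitian) (hA' : A'.IsHermitian) (hz : z.im ≠ 0)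
    {w : ι → ℂ} (h : A = A' + cross a w) :
    ‖(resolvent A z).trace - (resolvent A' z).trace‖ ≤ 2 * euclNorm w / |z.im| ^ 2 := by
  have hpos := abs_pos.2 hz
  have h1 : resolvent A z - resolvent A' z = - (resolvent A z * cross a w * resolvent A' z) := by
    have : cross a w = (A - z • 1) - (A' - z • 1) := by rw [h]; abel
    rw [this, mul_sub, resolvent_mul_sub hA hz, sub_mul, one_mul, mul_assoc,
      sub_mul_resolvent hA' hz, mul_one, neg_sub]
  have hz' : (star z).im ≠ 0 := by simpa using hz
  have hb : ∀ x y : ι → ℂ, ‖(resolvent A z * Matrix.vecMulVec x (star y)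
      * resolvent A' z).trace‖ ≤ euclNorm x * euclNorm y / |z.im| ^ 2 := by
    intro x y
    have e1 : (resolvent A z * Matrix.vecMulVec x (star y) * resolvent A' z).trace
        = star (resolvent A' (star z) *ᵥ y) ⬝ᵥ (resolvent A z *ᵥ x) := by
      rw [Matrix.mul_vecMulVec, Matrix.vecMulVec_mul, Matrix.trace_vecMulVec, dotProduct_comm,
        Matrix.star_mulVec, conjTranspose_resolvent hA', star_star]
    rw [e1]
    refine (norm_star_dotProduct_le _ _).trans ?_
    have e2 := euclNorm_resolvent_mulVec_le hA' hz' y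
    have e3 := euclNorm_resolvent_mulVec_le hA hz x
    have e4 : |(star z).im| = |z.im| := by simp
    rw [e4] at e2
    calc _ ≤ (euclNorm y / |z.im|) * (euclNorm x / |z.im|) :=
          mul_le_mul e2 e3 (euclNorm_nonneg _) (div_nonneg (euclNorm_nonneg _) hpos.le)
      _ = _ := by field_simp
  rw [← Matrix.trace_sub, h1, Matrix.trace_neg, norm_neg, cross, mul_add, add_mul,
    Matrix.trace_add]
  have e1 := hb (Pi.single a 1) w
  have e2 := hb w (Pi.single a 1)
  rw [Pi.star_single, star_one] at e2
  rw [euclNorm_single_one] at e1 e2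
  calc _ ≤ _ := norm_add_le _ _
    _ ≤ _ := add_le_add e1 e2
    _ = _ := by ring

end Resolvent

/-! ### Quadratic forms in fourwise orthogonal vectors -/

section QuadraticForm

variable {Ω κ : Type*} [Fintype Ω]

lemma sq_expect_le_expect_sq [Nonempty Ω] (f : Ω → ℝ) : (𝔼 ω, f ω) ^ 2 ≤ 𝔼 ω, f ω ^ 2 := by
  set m := 𝔼 ω, f ω with hm
  have h : 0 ≤ 𝔼 ω, (f ω - m) ^ 2 := Finset.expect_nonneg fun _ _ => sq_nonneg _
  have h2 : 𝔼 ω, (f ω - m) ^ 2 = 𝔼 ω, f ω ^ 2 - m ^ 2 := by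
    calc 𝔼 ω, (f ω - m) ^ 2 = 𝔼 ω, (f ω ^ 2 - f ω * (2 * m) + m ^ 2) :=
          Finset.expect_congr rfl fun _ _ => by ring
      _ = 𝔼 ω, f ω ^ 2 - m * (2 * m) + m ^ 2 := by
          rw [Finset.expect_add_distrib, Finset.expect_sub_distrib, ← Finset.expect_mul,
            Fintype.expect_const]
      _ = _ := by ring
  linarith

lemma expect_le_sqrt [Nonempty Ω] {f : Ω → ℝ} {c : ℝ} (h : 𝔼 ω, f ω ^ 2 ≤ c) :
    𝔼 ω, f ω ≤ √c :=
  Real.le_sqrt_of_sq_le ((sq_expect_le_expect_sq f).trans h)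

/-- A uniformly random vector `X` with unimodular coordinates whose coordinates are pairwise
orthogonal, and whose products `X j * conj (X k)`, for `j ≠ k`, are orthogonal unless they belong
to the same unordered pair. This is all that is used about a random codeword. -/
structure FourwiseOrthogonal (X : Ω → κ → ℂ) : Prop where
  norm_eq_one : ∀ ω j, ‖X ω j‖ = 1
  expect_pair : ∀ j k, j ≠ k → 𝔼 ω, X ω j * star (X ω k) = 0
  expect_quad : ∀ j k l m, j ≠ k → l ≠ m → ¬(j = l ∧ k = m) → ¬(j = m ∧ k = l) →
    𝔼 ω, X ω j * star (X ω k) * star (X ω l * star (X ω m)) = 0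

namespace FourwiseOrthogonal

variable {X : Ω → κ → ℂ}

lemma mul_star_self (hX : FourwiseOrthogonal X) (ω : Ω) (j : κ) : X ω j * star (X ω j) = 1 := by
  have := Complex.mul_conj (X ω j)
  rw [Complex.normSq_eq_norm_sq, hX.norm_eq_one] at this
  simpa using this

lemma norm_expect_quad_le [Nonempty Ω] [DecidableEq κ] (hX : FourwiseOrthogonal X) {q r : κ × κ}
    (hq : q.1 ≠ q.2) (hr : r.1 ≠ r.2) :
    ‖𝔼 ω, X ω q.1 * star (X ω q.2) * star (X ω r.1 * star (X ω r.2))‖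
      ≤ (if r = q then 1 else 0) + (if r = q.swap then 1 else 0) := by
  have hle : ‖𝔼 ω, X ω q.1 * star (X ω q.2) * star (X ω r.1 * star (X ω r.2))‖ ≤ 1 := by
    rw [Fintype.expect_eq_sum_div_card, norm_div, Complex.norm_natCast,
      div_le_one (by exact_mod_cast Fintype.card_pos)]
    refine (norm_sum_le _ _).trans (le_of_eq ?_)
    simp [hX.norm_eq_one]
  split_ifs with h1 h2 h2
  · linarith
  · linarith
  · linarith
  · rw [hX.expect_quad _ _ _ _ hq hr, norm_zero, add_zero]
    · rintro ⟨h, h'⟩; exact h1 (Prod.ext h.symm h'.symm)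
    · rintro ⟨h, h'⟩; exact h2 (Prod.ext h'.symm h.symm)

variable [Fintype κ]

variable [DecidableEq κ]

lemma quadForm_sub_trace (hX : FourwiseOrthogonal X) (B : Matrix κ κ ℂ) (ω : Ω) :
    X ω ⬝ᵥ (B *ᵥ star (X ω)) - B.trace
      = ∑ q ∈ Finset.univ.offDiag, B q.1 q.2 * (X ω q.1 * star (X ω q.2)) := by
  have h1 : X ω ⬝ᵥ (B *ᵥ star (X ω))
      = ∑ q ∈ (Finset.univ : Finset κ) ×ˢ (Finset.univ : Finset κ),
          B q.1 q.2 * (X ω q.1 * star (X ω q.2)) := by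
    rw [Finset.sum_product]
    simp only [dotProduct, Matrix.mulVec, Finset.mul_sum, Pi.star_apply]
    exact Finset.sum_congr rfl fun _ _ => Finset.sum_congr rfl fun _ _ => by ring
  rw [h1, ← Finset.diag_union_offDiag, Finset.sum_union (Finset.disjoint_diag_offDiag _),
    Finset.sum_diag]
  simp only [hX.mul_star_self, mul_one]
  rw [Matrix.trace]
  simp only [Matrix.diag_apply]
  ring

lemma expect_quadForm [Nonempty Ω] (hX : FourwiseOrthogonal X) (B : Matrix κ κ ℂ) :
    𝔼 ω, X ω ⬝ᵥ (B *ᵥ star (X ω)) = B.trace := by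
  have : 𝔼 ω, (X ω ⬝ᵥ (B *ᵥ star (X ω)) - B.trace) = 0 := by
    simp only [hX.quadForm_sub_trace B]
    rw [Finset.expect_sum_comm]
    refine Finset.sum_eq_zero fun q hq => ?_
    rw [← Finset.mul_expect, hX.expect_pair _ _ (Finset.mem_offDiag.1 hq).2.2, mul_zero]
  rwa [Finset.expect_sub_distrib, Fintype.expect_const, sub_eq_zero] at this

/-- The variance of a quadratic form is at most twice the squared Frobenius norm of its matrix. -/
lemma expect_norm_quadForm_sub_sq_le [Nonempty Ω] (hX : FourwiseOrthogonal X)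
    (B : Matrix κ κ ℂ) :
    𝔼 ω, ‖X ω ⬝ᵥ (B *ᵥ star (X ω)) - B.trace‖ ^ 2 ≤ 2 * ∑ j, ∑ k, ‖B j k‖ ^ 2 := by
  set D := (Finset.univ : Finset κ).offDiag with hD
  set g : Ω → κ × κ → ℂ := fun ω q => X ω q.1 * star (X ω q.2) with hg
  set b : κ × κ → ℝ := fun q => ‖B q.1 q.2‖ with hb
  have h1 : ((𝔼 ω, ‖X ω ⬝ᵥ (B *ᵥ star (X ω)) - B.trace‖ ^ 2 : ℝ) : ℂ)
      = ∑ q ∈ D, ∑ r ∈ D, B q.1 q.2 * star (B r.1 r.2) * 𝔼 ω, g ω q * star (g ω r) := by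
    have : ∀ ω, ((‖X ω ⬝ᵥ (B *ᵥ star (X ω)) - B.trace‖ ^ 2 : ℝ) : ℂ)
        = ∑ q ∈ D, ∑ r ∈ D, B q.1 q.2 * star (B r.1 r.2) * (g ω q * star (g ω r)) := by
      intro ω
      rw [hX.quadForm_sub_trace B, ← Complex.normSq_eq_norm_sq, ← Complex.mul_conj,
        map_sum, Finset.sum_mul_sum]
      refine Finset.sum_congr rfl fun q _ => Finset.sum_congr rfl fun r _ => ?_
      simp only [hg, star_mul', map_mul, RCLike.star_def, Complex.conj_conj]
      ring
    rw [Fintype.expect_eq_sum_div_card]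
    push_cast
    rw [← Fintype.expect_eq_sum_div_card]
    push_cast at this
    simp only [this]
    rw [Finset.expect_sum_comm]
    refine Finset.sum_congr rfl fun q _ => ?_
    rw [Finset.expect_sum_comm]
    refine Finset.sum_congr rfl fun r _ => ?_
    rw [Finset.mul_expect]
  have h0 : 0 ≤ 𝔼 ω, ‖X ω ⬝ᵥ (B *ᵥ star (X ω)) - B.trace‖ ^ 2 :=
    Finset.expect_nonneg fun _ _ => sq_nonneg _
  have h2 : 𝔼 ω, ‖X ω ⬝ᵥ (B *ᵥ star (X ω)) - B.trace‖ ^ 2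
      ≤ ∑ q ∈ D, ∑ r ∈ D, b q * b r *
          ((if r = q then 1 else 0) + (if r = q.swap then 1 else 0)) := by
    rw [← Complex.norm_of_nonneg h0, h1]
    refine norm_sum_le_of_le _ fun q hq => norm_sum_le_of_le _ fun r hr => ?_
    rw [norm_mul, norm_mul, norm_star]
    exact mul_le_mul_of_nonneg_left (hX.norm_expect_quad_le (Finset.mem_offDiag.1 hq).2.2
      (Finset.mem_offDiag.1 hr).2.2) (by positivity)
  have h3 : ∀ q ∈ D, ∑ r ∈ D, b q * b r *
      ((if r = q then 1 else 0) + (if r = q.swap then 1 else 0)) = b q ^ 2 + b q * b q.swap := by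
    intro q hq
    have hs : q.swap ∈ D := by
      simp only [hD, Finset.mem_offDiag, Finset.mem_univ, true_and, Prod.fst_swap,
        Prod.snd_swap] at hq ⊢
      exact hq.symm
    simp only [mul_add, Finset.sum_add_distrib, mul_ite, mul_one, mul_zero, Finset.sum_ite_eq',
      hq, hs, if_true]
    ring
  have h4 : ∑ q ∈ D, b q.swap ^ 2 = ∑ q ∈ D, b q ^ 2 := by
    refine Finset.sum_nbij' Prod.swap Prod.swap ?_ ?_ ?_ ?_ ?_
    · intro q hq
      simp only [hD, Finset.mem_offDiag, Finset.mem_univ, true_and, Prod.fst_swap,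
        Prod.snd_swap] at hq ⊢
      exact hq.symm
    · intro q hq
      simp only [hD, Finset.mem_offDiag, Finset.mem_univ, true_and, Prod.fst_swap,
        Prod.snd_swap] at hq ⊢
      exact hq.symm
    · simp
    · simp
    · simp
  rw [Finset.sum_congr rfl h3] at h2
  have h5 : ∑ q ∈ D, (b q ^ 2 + b q * b q.swap) ≤ 2 * ∑ q ∈ D, b q ^ 2 := by
    calc ∑ q ∈ D, (b q ^ 2 + b q * b q.swap)
        ≤ ∑ q ∈ D, (b q ^ 2 + (b q ^ 2 + b q.swap ^ 2) / 2) :=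
          Finset.sum_le_sum fun q _ => by nlinarith [sq_nonneg (b q - b q.swap)]
      _ = _ := by rw [Finset.sum_add_distrib, ← Finset.sum_div, Finset.sum_add_distrib, h4]; ring
  have h6 : ∑ q ∈ D, b q ^ 2 ≤ ∑ j, ∑ k, ‖B j k‖ ^ 2 := by
    rw [← Finset.sum_product']
    exact Finset.sum_le_sum_of_subset_of_nonneg
      (fun _ _ => Finset.mem_product.2 ⟨Finset.mem_univ _, Finset.mem_univ _⟩) fun _ _ _ => sq_nonneg _
  linarith

end FourwiseOrthogonal

end QuadraticForm

/-! ### Resampling one row -/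

/-- Averaging over all functions is unaffected by resampling one value. -/
lemma expect_update {ι Ω : Type*} [Fintype ι] [DecidableEq ι] [Fintype Ω]
    (a : ι) (g : (ι → Ω) → ℝ) :
    𝔼 s, 𝔼 v, g (Function.update s a v) = 𝔼 s, g s := by
  cases isEmpty_or_nonempty Ω
  · have : IsEmpty (ι → Ω) := ⟨fun s => isEmptyElim (s a)⟩
    simp
  have h1 : 𝔼 s : ι → Ω, g s = 𝔼 s : ι → Ω, 𝔼 _v : Ω, g s := by
    simp only [Fintype.expect_const]
  rw [h1, ← Finset.expect_product', ← Finset.expect_product']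
  refine Finset.expect_nbij' (fun x => (Function.update x.1 a x.2, x.1 a))
    (fun x => (Function.update x.1 a x.2, x.1 a)) ?_ ?_ ?_ ?_ ?_ <;> simp

/-! ### The self-consistent equation -/

lemma norm_sq_add_three_le (x y w : ℂ) :
    ‖x + y + w‖ ^ 2 ≤ 3 * (‖x‖ ^ 2 + ‖y‖ ^ 2 + ‖w‖ ^ 2) := by
  have h : ‖x + y + w‖ ≤ ‖x‖ + ‖y‖ + ‖w‖ := norm_add₃_le
  calc ‖x + y + w‖ ^ 2 ≤ (‖x‖ + ‖y‖ + ‖w‖) ^ 2 := pow_le_pow_left₀ (norm_nonneg _) h 2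
    _ ≤ _ := by nlinarith [sq_nonneg (‖x‖ - ‖y‖), sq_nonneg (‖x‖ - ‖w‖), sq_nonneg (‖y‖ - ‖w‖)]

lemma sum_norm_sq_eq_trace {m : Type*} [Fintype m] (B : Matrix m m ℂ) :
    ((∑ j, ∑ k, ‖B j k‖ ^ 2 : ℝ) : ℂ) = (B * Bᴴ).trace := by
  simp only [Matrix.trace, Matrix.diag_apply, Matrix.mul_apply, Matrix.conjTranspose_apply]
  push_cast
  refine Finset.sum_congr rfl fun j _ => Finset.sum_congr rfl fun k _ => ?_
  rw [← Complex.ofReal_pow, ← Complex.normSq_eq_norm_sq, ← Complex.mul_conj]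
  rfl

lemma norm_trace_mul_le {m : Type*} [Fintype m] (B C : Matrix m m ℂ) :
    ‖(B * C).trace‖ ≤ (∑ j, ∑ k, ‖B j k‖ ^ 2 + ∑ j, ∑ k, ‖C j k‖ ^ 2) / 2 := by
  rw [Finset.sum_comm (f := fun j k => ‖C j k‖ ^ 2), ← Finset.sum_add_distrib, Finset.sum_div]
  refine norm_sum_le_of_le _ fun j _ => ?_
  rw [Matrix.diag_apply, Matrix.mul_apply, ← Finset.sum_add_distrib, Finset.sum_div]
  refine norm_sum_le_of_le _ fun k _ => ?_
  rw [norm_mul]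
  nlinarith [sq_nonneg (‖B j k‖ - ‖C k j‖)]

section SelfConsistent

variable {ι κ : Type*} [Fintype ι] [Fintype κ]

/-- The scale `√(p n)` of the inner products of the rows of a `p × n` matrix. -/
def gramScale (ι κ : Type*) [Fintype ι] [Fintype κ] : ℝ :=
  √((Fintype.card ι : ℝ) * (Fintype.card κ : ℝ))

lemma gramScale_sq : gramScale ι κ ^ 2 = (Fintype.card ι : ℝ) * (Fintype.card κ : ℝ) :=
  Real.sq_sqrt (by positivity)

lemma gramScale_pos [Nonempty ι] [Nonempty κ] : 0 < gramScale ι κ :=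
  Real.sqrt_pos.2 (mul_pos (by exact_mod_cast Fintype.card_pos) (by exact_mod_cast Fintype.card_pos))

variable [DecidableEq ι]

/-- The Gram matrix `V V*` of the rows of a `p × n` matrix `V`, with its diagonal removed and
divided by `√(p n)`. -/
def crossGram (V : Matrix ι κ ℂ) : Matrix ι ι ℂ :=
  Matrix.of fun a b => if a = b then 0 else (V * Vᴴ) a b / (gramScale ι κ : ℂ)

lemma crossGram_isHermitian (V : Matrix ι κ ℂ) : (crossGram V).IsHermitian := by
  have h : (V * Vᴴ).IsHermitian := Matrix.isHermitian_mul_conjTranspose_self V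
  ext a b
  simp only [Matrix.conjTranspose_apply, crossGram, Matrix.of_apply]
  rcases eq_or_ne a b with rfl | hab
  · simp
  · rw [if_neg hab, if_neg hab.symm, star_div₀, h.apply]
    simp

/-- The matrix `1 - e_a e_a*`. -/
def diagOff (a : ι) : Matrix ι ι ℂ := Matrix.diagonal fun b => if b = a then 0 else 1

lemma trace_mul_diagOff (R : Matrix ι ι ℂ) (a : ι) :
    (R * diagOff a).trace = R.trace - R a a := by
  simp only [Matrix.trace, Matrix.diag_apply, diagOff, Matrix.mul_diagonal, mul_ite, mul_zero,
    mul_one]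
  rw [← Finset.sum_erase_add _ _ (Finset.mem_univ a), if_pos rfl, add_zero, eq_sub_iff_add_eq,
    ← Finset.sum_erase_add _ (fun i => R i i) (Finset.mem_univ a)]
  congr 1
  exact Finset.sum_congr rfl fun i hi => if_neg (Finset.ne_of_mem_erase hi)

variable {V V' : Matrix ι κ ℂ} {a : ι} {z : ℂ}

lemma crossGram_row_eq_zero (h0 : ∀ j, V' a j = 0) (b : ι) : crossGram V' a b = 0 := by
  simp [crossGram, Matrix.mul_apply, h0]

/-- Column `a` of `crossGram V`, in terms of row `a` of `V` and of the other rows. -/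
lemma crossGram_col (V : Matrix ι κ ℂ) (a : ι) :
    (crossGram V).col a = (gramScale ι κ : ℂ)⁻¹ • (V.updateRow a 0 *ᵥ star (V a)) := by
  ext b
  simp only [Matrix.col_apply, crossGram, Matrix.of_apply, Pi.smul_apply, smul_eq_mul,
    Matrix.mulVec, dotProduct, Pi.star_apply]
  rcases eq_or_ne b a with rfl | hab
  · simp
  · rw [if_neg hab, Matrix.mul_apply, div_eq_inv_mul]
    simp [hab, Matrix.updateRow_ne]

lemma crossGram_eq_add_cross (V : Matrix ι κ ℂ) (a : ι) :
    crossGram V = crossGram (V.updateRow a 0) + cross a ((crossGram V).col a) := by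
  have hH := crossGram_isHermitian V
  ext b c
  simp only [Matrix.add_apply, cross, Matrix.vecMulVec_apply, Pi.star_apply, Matrix.col_apply,
    hH.apply]
  rcases eq_or_ne b a with rfl | hb
  · rcases eq_or_ne c b with rfl | hc
    · simp [crossGram]
    · simp [crossGram, Matrix.mul_apply, Matrix.updateRow_ne, hc]
  · rcases eq_or_ne c a with rfl | hc
    · simp [crossGram, Matrix.mul_apply, hb]
    · simp [crossGram, Matrix.mul_apply, Matrix.updateRow_ne, hb, hc]

/-- The Gram matrix when row `a` vanishes and all other entries are unimodular. -/
lemma mul_conjTranspose_eq [Nonempty ι] [Nonempty κ] (h0 : ∀ j, V' a j = 0)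
    (h1 : ∀ b, b ≠ a → ∀ j, ‖V' b j‖ = 1) :
    V' * V'ᴴ = (Fintype.card κ : ℂ) • diagOff a + (gramScale ι κ : ℂ) • crossGram V' := by
  have ht : (gramScale ι κ : ℂ) ≠ 0 := by exact_mod_cast (gramScale_pos (ι := ι) (κ := κ)).ne'
  ext b c
  simp only [Matrix.add_apply, Matrix.smul_apply, crossGram, Matrix.of_apply, smul_eq_mul, diagOff,
    Matrix.diagonal_apply]
  rcases eq_or_ne b c with rfl | hbc
  · rcases eq_or_ne b a with rfl | hb
    · simp [Matrix.mul_apply, h0]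
    · have : ∀ j, V' b j * star (V' b j) = 1 := by
        intro j
        have := Complex.mul_conj (V' b j)
        rw [Complex.normSq_eq_norm_sq, h1 b hb] at this
        simpa using this
      simp only [Matrix.mul_apply, Matrix.conjTranspose_apply, this, hb]
      simp
  · rw [if_neg hbc, if_neg hbc]
    field_simp
    simp

/-- The matrix of the quadratic form, in row `a`, that appears in Schur's complement formula. -/
def schurForm (V' : Matrix ι κ ℂ) (z : ℂ) : Matrix κ κ ℂ :=
  ((gramScale ι κ : ℂ)⁻¹ ^ 2) • (V'ᴴ * resolvent (crossGram V') z * V')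

lemma star_col_dotProduct_resolvent_mulVec (V : Matrix ι κ ℂ) (a : ι) (z : ℂ) :
    star ((crossGram V).col a) ⬝ᵥ
        (resolvent (crossGram (V.updateRow a 0)) z *ᵥ (crossGram V).col a)
      = V a ⬝ᵥ (schurForm (V.updateRow a 0) z *ᵥ star (V a)) := by
  rw [crossGram_col, schurForm, star_smul, Matrix.mulVec_smul, smul_dotProduct, dotProduct_smul,
    Matrix.star_mulVec, star_star, Matrix.smul_mulVec, dotProduct_smul, ← Matrix.mulVec_mulVec,
    ← Matrix.mulVec_mulVec, ← Matrix.dotProduct_mulVec, smul_smul]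
  congr 1
  simp [pow_two]

section Bounds

variable [Nonempty ι] [Nonempty κ]

lemma trace_schurForm (h0 : ∀ j, V' a j = 0) (h1 : ∀ b, b ≠ a → ∀ j, ‖V' b j‖ = 1)
    (hz : z.im ≠ 0) :
    (schurForm V' z).trace
      = (Fintype.card ι : ℂ)⁻¹ * ((resolvent (crossGram V') z).trace
          - resolvent (crossGram V') z a a)
        + (gramScale ι κ : ℂ)⁻¹ * (Fintype.card ι + z * (resolvent (crossGram V') z).trace) := by
  have ht : (gramScale ι κ : ℂ) ≠ 0 := by exact_mod_cast (gramScale_pos (ι := ι) (κ := κ)).ne'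
  have hp : (Fintype.card ι : ℂ) ≠ 0 := by exact_mod_cast (Fintype.card_pos (α := ι)).ne'
  have hn : (Fintype.card κ : ℂ) ≠ 0 := by exact_mod_cast (Fintype.card_pos (α := κ)).ne'
  have hsq : (gramScale ι κ : ℂ) ^ 2 = (Fintype.card ι : ℂ) * (Fintype.card κ : ℂ) := by
    exact_mod_cast congrArg Complex.ofReal (gramScale_sq (ι := ι) (κ := κ))
  rw [schurForm, Matrix.trace_smul, Matrix.mul_assoc, Matrix.trace_mul_comm, Matrix.mul_assoc,
    mul_conjTranspose_eq h0 h1, mul_add, mul_smul_comm, mul_smul_comm, Matrix.trace_add,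
    Matrix.trace_smul, Matrix.trace_smul, trace_mul_diagOff,
    resolvent_mul (crossGram_isHermitian V') hz, Matrix.trace_add, Matrix.trace_one,
    Matrix.trace_smul]
  simp only [smul_eq_mul]
  rw [inv_pow, mul_add, ← mul_assoc, ← mul_assoc, hsq]
  congr 1
  · congr 1
    field_simp
  · congr 1
    rw [← hsq]
    field_simp

lemma norm_trace_schurForm_sub_le (h0 : ∀ j, V' a j = 0)
    (h1 : ∀ b, b ≠ a → ∀ j, ‖V' b j‖ = 1) (hz : 0 < z.im) {K : ℝ} (hK : ‖z‖ ≤ K) :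
    ‖(Fintype.card ι : ℂ)⁻¹ * (resolvent (crossGram V') z).trace - (schurForm V' z).trace‖
      ≤ 1 / (Fintype.card ι * z.im)
        + (Fintype.card ι / gramScale ι κ) * (1 + K / z.im) := by
  have hp : (0 : ℝ) < Fintype.card ι := by exact_mod_cast Fintype.card_pos
  have ht := gramScale_pos (ι := ι) (κ := κ)
  have hA := crossGram_isHermitian V'
  have e1 := norm_resolvent_apply_le hA hz.ne' a a
  have e2 := norm_trace_resolvent_le hA hz.ne'
  rw [abs_of_pos hz] at e1 e2
  set R := resolvent (crossGram V') z
  have h : (Fintype.card ι : ℂ)⁻¹ * R.trace - (schurForm V' z).trace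
      = (Fintype.card ι : ℂ)⁻¹ * R a a
        - (gramScale ι κ : ℂ)⁻¹ * (Fintype.card ι + z * R.trace) := by
    rw [trace_schurForm h0 h1 hz.ne']; ring
  rw [h]
  refine (norm_sub_le _ _).trans (add_le_add ?_ ?_)
  · rw [norm_mul, norm_inv, Complex.norm_natCast]
    calc _ ≤ (Fintype.card ι : ℝ)⁻¹ * (1 / z.im) := by gcongr
      _ = _ := by field_simp
  · rw [norm_mul, norm_inv, Complex.norm_real, Real.norm_of_nonneg ht.le]
    have : ‖(Fintype.card ι : ℂ) + z * R.trace‖ ≤ Fintype.card ι + K * (Fintype.card ι / z.im) := by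
      refine (norm_add_le _ _).trans ?_
      rw [Complex.norm_natCast, norm_mul]
      gcongr
      exact (norm_nonneg z).trans hK
    calc _ ≤ (gramScale ι κ)⁻¹ * (Fintype.card ι + K * (Fintype.card ι / z.im)) := by gcongr
      _ = _ := by field_simp

/-- The bound for the squared Frobenius norm of `schurForm`. -/
def schurFormBound (p t η K : ℝ) : ℝ :=
  3 / p * (1 / η ^ 2 + (p / t) ^ 2 * (1 + K ^ 2 / η ^ 2))

lemma sum_norm_sq_resolvent_mul_gram_le (h0 : ∀ j, V' a j = 0)
    (h1 : ∀ b, b ≠ a → ∀ j, ‖V' b j‖ = 1) (hz : z.im ≠ 0) {K : ℝ} (hK : ‖z‖ ≤ K) :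
    ∑ b, ∑ c, ‖(((gramScale ι κ : ℂ)⁻¹ ^ 2) •
        (resolvent (crossGram V') z * (V' * V'ᴴ))) b c‖ ^ 2
      ≤ schurFormBound (Fintype.card ι) (gramScale ι κ) |z.im| K := by
  have hp : (0 : ℝ) < Fintype.card ι := by exact_mod_cast Fintype.card_pos
  have ht := gramScale_pos (ι := ι) (κ := κ)
  have hη := abs_pos.2 hz
  have hA := crossGram_isHermitian V'
  have hF := sum_norm_sq_resolvent_le hA hz
  have hsq : (gramScale ι κ : ℂ) ^ 2 = (Fintype.card ι : ℂ) * (Fintype.card κ : ℂ) := by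
    exact_mod_cast congrArg Complex.ofReal (gramScale_sq (ι := ι) (κ := κ))
  have htc : (gramScale ι κ : ℂ) ≠ 0 := by exact_mod_cast ht.ne'
  have hn : (Fintype.card κ : ℂ) ≠ 0 := by exact_mod_cast (Fintype.card_pos (α := κ)).ne'
  have hmul : resolvent (crossGram V') z * (V' * V'ᴴ)
      = (Fintype.card κ : ℂ) • (resolvent (crossGram V') z * diagOff a)
        + (gramScale ι κ : ℂ) • (1 + z • resolvent (crossGram V') z) := by
    rw [mul_conjTranspose_eq h0 h1, mul_add, mul_smul_comm, mul_smul_comm, resolvent_mul hA hz]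
  rw [hmul]
  set R := resolvent (crossGram V') z
  set p : ℝ := (Fintype.card ι : ℝ) with hpdef
  set t : ℝ := gramScale ι κ with htdef
  have hentry : ∀ b c, ‖(((t : ℂ)⁻¹ ^ 2) • ((Fintype.card κ : ℂ) • (R * diagOff a)
      + (t : ℂ) • (1 + z • R))) b c‖ ^ 2
      ≤ 3 * (‖R b c‖ ^ 2 / p ^ 2 + (if b = c then 1 else 0) / t ^ 2
          + K ^ 2 / t ^ 2 * ‖R b c‖ ^ 2) := by
    intro b c
    have e1 : (((t : ℂ)⁻¹ ^ 2) • ((Fintype.card κ : ℂ) • (R * diagOff a)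
        + (t : ℂ) • (1 + z • R))) b c
        = (R b c * (if c = a then 0 else 1)) / (p : ℂ) + (if b = c then 1 else 0) / (t : ℂ)
          + z * R b c / (t : ℂ) := by
      simp only [Matrix.smul_apply, Matrix.add_apply, smul_eq_mul, diagOff, Matrix.mul_diagonal,
        Matrix.one_apply]
      have e2 : (p : ℂ)⁻¹ = (t : ℂ)⁻¹ ^ 2 * (Fintype.card κ : ℂ) := by
        rw [inv_pow, hsq, hpdef]
        push_cast
        field_simp
      rw [div_eq_mul_inv _ (p : ℂ), e2]
      field_simp
      ring
    rw [e1]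
    refine (norm_sq_add_three_le _ _ _).trans ?_
    have f1 : ‖R b c * (if c = a then 0 else 1) / (p : ℂ)‖ ^ 2 ≤ ‖R b c‖ ^ 2 / p ^ 2 := by
      rw [norm_div, Complex.norm_real, Real.norm_of_nonneg hp.le, div_pow]
      gcongr
      split_ifs <;> simp
    have f2 : ‖(if b = c then (1 : ℂ) else 0) / (t : ℂ)‖ ^ 2 = (if b = c then 1 else 0) / t ^ 2 := by
      rw [norm_div, Complex.norm_real, Real.norm_of_nonneg ht.le, div_pow]
      split_ifs <;> simp
    have f3 : ‖z * R b c / (t : ℂ)‖ ^ 2 ≤ K ^ 2 / t ^ 2 * ‖R b c‖ ^ 2 := by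
      rw [norm_div, Complex.norm_real, Real.norm_of_nonneg ht.le, div_pow, norm_mul, mul_pow,
        div_mul_eq_mul_div]
      gcongr
    rw [f2]
    gcongr
  refine (Finset.sum_le_sum fun b _ => Finset.sum_le_sum fun c _ => hentry b c).trans ?_
  simp only [← Finset.mul_sum, Finset.sum_add_distrib, ← Finset.sum_div, Finset.sum_ite_eq,
    Finset.mem_univ, if_true, Finset.sum_const, Finset.card_univ, nsmul_eq_mul, mul_one]
  calc _ ≤ 3 * ((p / |z.im| ^ 2) / p ^ 2 + p / t ^ 2 + K ^ 2 / t ^ 2 * (p / |z.im| ^ 2)) := by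
        gcongr
    _ = _ := by
        rw [schurFormBound]
        field_simp
        ring

/-- The squared Frobenius norm of `schurForm V' z` is the trace of the product of `R G` and
`R* G`, where `G` is the Gram matrix and `R` the resolvent; both factors are explicit in `R`. -/
lemma sum_norm_sq_schurForm_le (h0 : ∀ j, V' a j = 0) (h1 : ∀ b, b ≠ a → ∀ j, ‖V' b j‖ = 1)
    (hz : 0 < z.im) {K : ℝ} (hK : ‖z‖ ≤ K) :
    ∑ j, ∑ k, ‖schurForm V' z j k‖ ^ 2
      ≤ schurFormBound (Fintype.card ι) (gramScale ι κ) z.im K := by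
  have hA := crossGram_isHermitian V'
  have hz' : (star z).im ≠ 0 := by simpa using hz.ne'
  have e1 := sum_norm_sq_resolvent_mul_gram_le h0 h1 hz.ne' hK
  have e2 := sum_norm_sq_resolvent_mul_gram_le h0 h1 hz' ((norm_star z).trans_le hK)
  have e3 : |(star z).im| = z.im := by simp [abs_of_pos hz]
  rw [abs_of_pos hz] at e1
  rw [e3] at e2
  have hsum : ((∑ j, ∑ k, ‖schurForm V' z j k‖ ^ 2 : ℝ) : ℂ)
      = ((((gramScale ι κ : ℂ)⁻¹ ^ 2) • (resolvent (crossGram V') z * (V' * V'ᴴ)))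
        * (((gramScale ι κ : ℂ)⁻¹ ^ 2) • (resolvent (crossGram V') (star z) * (V' * V'ᴴ)))).trace := by
    rw [sum_norm_sq_eq_trace, schurForm, Matrix.conjTranspose_smul, Matrix.conjTranspose_mul,
      Matrix.conjTranspose_mul, Matrix.conjTranspose_conjTranspose, conjTranspose_resolvent hA]
    have hr : star ((gramScale ι κ : ℂ)⁻¹ ^ 2) = (gramScale ι κ : ℂ)⁻¹ ^ 2 := by
      simp
    rw [hr, smul_mul_smul_comm, smul_mul_smul_comm, Matrix.trace_smul, Matrix.trace_smul]
    congr 1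
    simp only [Matrix.mul_assoc]
    rw [Matrix.trace_mul_comm]
    simp only [Matrix.mul_assoc]
  have hnn : 0 ≤ ∑ j, ∑ k, ‖schurForm V' z j k‖ ^ 2 := by positivity
  rw [← Complex.norm_of_nonneg hnn, hsum]
  refine (norm_trace_mul_le _ _).trans ?_
  linarith

end Bounds

end SelfConsistent

section SelfConsistentMean

variable {Ω ι κ : Type*} [Fintype Ω] [Nonempty Ω] [Fintype ι] [DecidableEq ι] [Nonempty ι]
  [Fintype κ]

/-- The Stieltjes transform `(1/p) tr (M - z)⁻¹` of the spectrum of `M = crossGram V`. -/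
def stieltjes (V : Matrix ι κ ℂ) (z : ℂ) : ℂ :=
  (Fintype.card ι : ℂ)⁻¹ * (resolvent (crossGram V) z).trace

/-- The bound for the mean error in the self-consistent equation of the semicircle law. -/
def meanErrorBound (p t η K : ℝ) : ℝ :=
  1 / η * (2 / (p * η ^ 2) + (1 / (p * η) + p / t * (1 + K / η)) + √(2 * schurFormBound p t η K))

/-- The diagonal entries of the resolvent turn the self-consistent equation into an average of the
fluctuations of the Schur complements. -/
lemma norm_stieltjes_sq_add_le (V : Matrix ι κ ℂ) {z : ℂ} (hz : 0 < z.im) :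
    ‖stieltjes V z ^ 2 + z * stieltjes V z + 1‖
      ≤ 1 / z.im * 𝔼 a, ‖stieltjes V z
          - V a ⬝ᵥ (schurForm (V.updateRow a 0) z *ᵥ star (V a))‖ := by
  have hA := crossGram_isHermitian V
  set R := resolvent (crossGram V) z with hR
  set s := stieltjes V z with hs
  set Q : ι → ℂ := fun a => V a ⬝ᵥ (schurForm (V.updateRow a 0) z *ᵥ star (V a)) with hQ
  have hschur : ∀ a, 1 + R a a * (z + Q a) = 0 := by
    intro a
    have h := one_add_resolvent_apply_mul hA (crossGram_isHermitian (V.updateRow a 0)) hz.ne'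
      (a := a) (crossGram_row_eq_zero (by simp)) (w := (crossGram V).col a) (by simp [crossGram])
      (crossGram_eq_add_cross V a)
    rwa [star_col_dotProduct_resolvent_mulVec] at h
  have hsE : s = 𝔼 a, R a a := by
    rw [Fintype.expect_eq_sum_div_card, hs, stieltjes, div_eq_inv_mul]
    rfl
  have h1 : s ^ 2 + z * s + 1 = 𝔼 a, R a a * (s - Q a) := by
    calc s ^ 2 + z * s + 1 = 𝔼 a, (R a a * (z + s) + 1) := by
          rw [Finset.expect_add_distrib, ← Finset.expect_mul, ← hsE, Fintype.expect_const]
          ring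
      _ = _ := Finset.expect_congr rfl fun a _ => by linear_combination hschur a
  rw [h1, Fintype.expect_eq_sum_div_card, Fintype.expect_eq_sum_div_card, norm_div,
    Complex.norm_natCast, ← mul_div_assoc, Finset.mul_sum]
  gcongr
  refine norm_sum_le_of_le _ fun a _ => ?_
  rw [norm_mul]
  have := norm_resolvent_apply_le hA hz.ne' a a
  rw [abs_of_pos hz] at this
  gcongr

variable [DecidableEq κ] [Nonempty κ]

/-- The mean fluctuation of one Schur complement, when the other rows are kept fixed. -/
lemma expect_norm_stieltjes_sub_le {X : Ω → κ → ℂ} (hX : FourwiseOrthogonal X)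
    (V : Matrix ι κ ℂ) (hV : ∀ b j, ‖V b j‖ = 1) (a : ι) {z : ℂ} (hz : 0 < z.im) {K : ℝ}
    (hK : ‖z‖ ≤ K) :
    𝔼 ω, ‖stieltjes (V.updateRow a (X ω)) z
        - X ω ⬝ᵥ (schurForm (V.updateRow a 0) z *ᵥ star (X ω))‖
      ≤ 2 / (Fintype.card ι * z.im ^ 2)
        + (1 / (Fintype.card ι * z.im) + Fintype.card ι / gramScale ι κ * (1 + K / z.im))
        + √(2 * schurFormBound (Fintype.card ι) (gramScale ι κ) z.im K) := by
  have hp : (0 : ℝ) < Fintype.card ι := by exact_mod_cast Fintype.card_pos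
  have ht := gramScale_pos (ι := ι) (κ := κ)
  set V' := V.updateRow a 0 with hV'
  have h0 : ∀ j, V' a j = 0 := by simp [hV']
  have h1 : ∀ b, b ≠ a → ∀ j, ‖V' b j‖ = 1 := fun b hb j => by
    rw [hV', Matrix.updateRow_ne hb]; exact hV b j
  set t := gramScale ι κ with htdef
  set w : Ω → ι → ℂ := fun ω => (t : ℂ)⁻¹ • (V' *ᵥ star (X ω)) with hw
  set B := schurForm V' z
  -- removing row `a` costs a rank-two perturbation
  have hrank : ∀ ω, ‖stieltjes (V.updateRow a (X ω)) z - stieltjes V' z‖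
      ≤ (1 + euclNorm (w ω) ^ 2) / (Fintype.card ι * z.im ^ 2) := by
    intro ω
    have hrow : (V.updateRow a (X ω)).updateRow a 0 = V' := by
      rw [hV']
      ext b j
      rcases eq_or_ne b a with rfl | hb
      · simp
      · simp [Matrix.updateRow_ne, hb]
    have e1 := crossGram_eq_add_cross (V.updateRow a (X ω)) a
    rw [crossGram_col, hrow] at e1
    have e2 := norm_trace_resolvent_sub_le (crossGram_isHermitian _) (crossGram_isHermitian V')
      hz.ne' e1
    have e3 : (V.updateRow a (X ω)) a = X ω := by
      ext j; simp
    rw [e3, abs_of_pos hz] at e2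
    have e4 : euclNorm ((t : ℂ)⁻¹ • (V' *ᵥ star (X ω))) = euclNorm (w ω) := rfl
    rw [e4] at e2
    rw [stieltjes, stieltjes, ← mul_sub, norm_mul, norm_inv, Complex.norm_natCast]
    calc _ ≤ (Fintype.card ι : ℝ)⁻¹ * (2 * euclNorm (w ω) / z.im ^ 2) := by gcongr
      _ = 2 * euclNorm (w ω) / (Fintype.card ι * z.im ^ 2) := by field_simp
      _ ≤ _ := by
          gcongr
          nlinarith [sq_nonneg (euclNorm (w ω) - 1)]
  -- the removed column has mean square norm at most one
  have hwE : 𝔼 ω, euclNorm (w ω) ^ 2 ≤ 1 := by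
    have e1 : ∀ ω, ((euclNorm (w ω) ^ 2 : ℝ) : ℂ)
        = X ω ⬝ᵥ ((((t : ℂ)⁻¹ ^ 2) • (V'ᴴ * V')) *ᵥ star (X ω)) := by
      intro ω
      rw [← star_dotProduct_self, hw, star_smul, dotProduct_smul, smul_dotProduct,
        Matrix.star_mulVec, star_star, Matrix.smul_mulVec, dotProduct_smul, ← Matrix.mulVec_mulVec,
        ← Matrix.dotProduct_mulVec, smul_smul]
      congr 1
      simp [pow_two]
    have e2 : ((𝔼 ω, euclNorm (w ω) ^ 2 : ℝ) : ℂ) = (((t : ℂ)⁻¹ ^ 2) • (V'ᴴ * V')).trace := by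
      rw [← hX.expect_quadForm, Fintype.expect_eq_sum_div_card, Fintype.expect_eq_sum_div_card]
      simp only [← e1]
      push_cast
      rfl
    have hnn : 0 ≤ 𝔼 ω, euclNorm (w ω) ^ 2 := Finset.expect_nonneg fun _ _ => sq_nonneg _
    rw [← Complex.norm_of_nonneg hnn, e2, Matrix.trace_smul, Matrix.trace_mul_comm, norm_smul,
      norm_pow, norm_inv, Complex.norm_real, Real.norm_of_nonneg ht.le]
    have e3 : ‖(V' * V'ᴴ).trace‖ ≤ ∑ _b : ι, (Fintype.card κ : ℝ) := by
      refine norm_sum_le_of_le _ fun b _ => ?_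
      rw [Matrix.diag_apply, Matrix.mul_apply]
      refine (norm_sum_le_of_le (f := fun j => V' b j * V'ᴴ j b) _ (n := fun _ => 1)
        fun j _ => ?_).trans (by simp)
      rw [norm_mul, Matrix.conjTranspose_apply, norm_star]
      rcases eq_or_ne b a with rfl | hb
      · simp [h0]
      · simp [h1 b hb]
    have e4 : ∑ _b : ι, (Fintype.card κ : ℝ) = t ^ 2 := by
      rw [htdef, gramScale_sq]; simp
    rw [e4] at e3
    calc t⁻¹ ^ 2 * ‖(V' * V'ᴴ).trace‖ ≤ t⁻¹ ^ 2 * t ^ 2 := by gcongr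
      _ = 1 := by field_simp
  have htr := norm_trace_schurForm_sub_le h0 h1 hz hK
  have hvar : 𝔼 ω, ‖X ω ⬝ᵥ (B *ᵥ star (X ω)) - B.trace‖
      ≤ √(2 * schurFormBound (Fintype.card ι) t z.im K) := by
    refine expect_le_sqrt ((hX.expect_norm_quadForm_sub_sq_le B).trans ?_)
    gcongr
    exact sum_norm_sq_schurForm_le h0 h1 hz hK
  have hpt : ∀ ω, ‖stieltjes (V.updateRow a (X ω)) z - X ω ⬝ᵥ (B *ᵥ star (X ω))‖
      ≤ (1 + euclNorm (w ω) ^ 2) / (Fintype.card ι * z.im ^ 2)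
        + (1 / (Fintype.card ι * z.im) + Fintype.card ι / t * (1 + K / z.im))
        + ‖X ω ⬝ᵥ (B *ᵥ star (X ω)) - B.trace‖ := by
    intro ω
    have e : stieltjes (V.updateRow a (X ω)) z - X ω ⬝ᵥ (B *ᵥ star (X ω))
        = (stieltjes (V.updateRow a (X ω)) z - stieltjes V' z) + (stieltjes V' z - B.trace)
          + (B.trace - X ω ⬝ᵥ (B *ᵥ star (X ω))) := by ring
    rw [e, ← norm_sub_rev B.trace]
    exact norm_add₃_le.trans (add_le_add (add_le_add (hrank ω) htr) le_rfl)
  refine (Finset.expect_le_expect fun ω _ => hpt ω).trans ?_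
  rw [Finset.expect_add_distrib, Finset.expect_add_distrib, Fintype.expect_const]
  refine add_le_add (add_le_add ?_ le_rfl) hvar
  rw [← Finset.expect_div, Finset.expect_add_distrib, Fintype.expect_const]
  gcongr
  linarith

/-- In the mean, the Stieltjes transform of the normalised Gram matrix of independent rows
approximately satisfies the equation `m² + z m + 1 = 0` of the semicircle law. -/
lemma expect_norm_stieltjes_sq_add_le {X : Ω → κ → ℂ} (hX : FourwiseOrthogonal X) {z : ℂ}
    (hz : 0 < z.im) {K : ℝ} (hK : ‖z‖ ≤ K) :
    𝔼 s : ι → Ω, ‖stieltjes (Matrix.of fun b => X (s b)) z ^ 2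
        + z * stieltjes (Matrix.of fun b => X (s b)) z + 1‖
      ≤ meanErrorBound (Fintype.card ι) (gramScale ι κ) z.im K := by
  set W : (ι → Ω) → Matrix ι κ ℂ := fun s => Matrix.of fun b => X (s b) with hW
  refine (Finset.expect_le_expect fun s _ => norm_stieltjes_sq_add_le (W s) hz).trans ?_
  rw [← Finset.mul_expect, meanErrorBound, Finset.expect_comm]
  gcongr
  refine Finset.expect_le Finset.univ_nonempty fun a _ => ?_
  rw [← expect_update a]
  refine Finset.expect_le Finset.univ_nonempty fun s _ => ?_
  -- the other rows, and with them the quadratic form, do not depend on the resampled row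
  have hupd : ∀ v, W (Function.update s a v) = (W s).updateRow a (X v) := by
    intro v
    ext b j
    rcases eq_or_ne b a with rfl | hb
    · simp [hW]
    · simp [hW, hb, Matrix.updateRow_ne]
  have hrow : ∀ v, ((W s).updateRow a (X v)).updateRow a 0 = (W s).updateRow a 0 := by
    intro v
    ext b j
    rcases eq_or_ne b a with rfl | hb
    · simp
    · simp [hb, Matrix.updateRow_ne]
  have hself : ∀ v, (W s).updateRow a (X v) a = X v := fun v => by ext j; simp
  simp only [hupd, hrow, hself]
  exact expect_norm_stieltjes_sub_le hX (W s) (fun b j => hX.norm_eq_one _ _) a hz hK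

end SelfConsistentMean

/-! ### The semicircle law -/

lemma semicircleDensity_eq (u : ℝ) : semicircleDensity u = 1 / (2 * Real.pi) * √(4 - u ^ 2) := by
  by_cases h : u ∈ Set.Icc (-2 : ℝ) 2
  · rw [semicircleDensity, Set.indicator_of_mem h]
  · rw [semicircleDensity, Set.indicator_of_notMem h]
    rw [Real.sqrt_eq_zero_of_nonpos, mul_zero]
    by_contra! h'
    exact h ⟨by nlinarith, by nlinarith⟩

lemma pi_mul_semicircleDensity (u : ℝ) : Real.pi * semicircleDensity u = √(4 - u ^ 2) / 2 := by
  rw [semicircleDensity_eq]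
  field_simp

lemma continuous_semicircleDensity : Continuous semicircleDensity := by
  rw [funext semicircleDensity_eq]
  fun_prop

lemma semicircleDensity_nonneg (u : ℝ) : 0 ≤ semicircleDensity u := by
  rw [semicircleDensity_eq]; positivity

lemma semicircleDensity_le_one (u : ℝ) : semicircleDensity u ≤ 1 := by
  have h1 : √(4 - u ^ 2) ≤ 2 := Real.sqrt_le_iff.2 ⟨by norm_num, by nlinarith [sq_nonneg u]⟩
  have h2 := pi_mul_semicircleDensity u
  nlinarith [Real.pi_gt_three, semicircleDensity_nonneg u]

lemma semicircleDensity_eq_zero {u : ℝ} (h : 2 ≤ |u|) : semicircleDensity u = 0 := by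
  rw [semicircleDensity_eq, Real.sqrt_eq_zero_of_nonpos, mul_zero]
  nlinarith [sq_abs u]

lemma integral_semicircleDensity_eq_zero {a b : ℝ}
    (h : ∀ u ∈ Set.uIoc a b, 2 ≤ |u|) : ∫ u in a..b, semicircleDensity u = 0 := by
  rw [intervalIntegral.integral_congr_ae (g := fun _ => 0)
    (Eventually.of_forall fun u hu => semicircleDensity_eq_zero (h u hu))]
  simp

lemma integral_semicircleDensity_eq_one {a b : ℝ} (ha : a ≤ -2) (hb : 2 ≤ b) :
    ∫ u in a..b, semicircleDensity u = 1 := by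
  have hi : ∀ c d, IntervalIntegrable semicircleDensity volume c d := fun c d =>
    continuous_semicircleDensity.intervalIntegrable c d
  rw [← intervalIntegral.integral_add_adjacent_intervals (hi a (-2)) (hi (-2) b),
    ← intervalIntegral.integral_add_adjacent_intervals (hi (-2) 2) (hi 2 b),
    integral_semicircleDensity_eq_zero (a := a), integral_semicircleDensity_eq_zero (a := 2),
    zero_add, add_zero]
  · have h := intervalIntegral.integral_comp_mul_left (a := -1) (b := 1)
      (fun u => semicircleDensity u) (c := 2) two_ne_zero
    have h2 : ∀ u : ℝ, semicircleDensity (2 * u) = 1 / Real.pi * √(1 - u ^ 2) := by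
      intro u
      have : (4 - (2 * u) ^ 2 : ℝ) = 2 ^ 2 * (1 - u ^ 2) := by ring
      rw [semicircleDensity_eq, this, Real.sqrt_mul (by norm_num), Real.sqrt_sq (by norm_num)]
      field_simp
    simp only [h2] at h
    rw [intervalIntegral.integral_const_mul, integral_sqrt_one_sub_sq] at h
    norm_num at h
    have hpi := Real.pi_pos.ne'
    field_simp at h
    linarith
  · intro u hu
    rw [Set.uIoc_of_le hb] at hu
    exact hu.1.le.trans (le_abs_self u)
  · intro u hu
    rw [Set.uIoc_of_le ha] at hu
    exact (by linarith [hu.2] : 2 ≤ -u).trans (neg_le_abs u)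

lemma semicircleCDF_eq_integral {a x : ℝ} (ha : a ≤ -2) (hax : a ≤ x) :
    semicircleCDF x = ∫ u in a..x, semicircleDensity u := by
  have h0 : ∀ u ∈ Set.Iic a, semicircleDensity u = 0 := fun u hu =>
    semicircleDensity_eq_zero
      ((by linarith [Set.mem_Iic.1 hu] : 2 ≤ -u).trans (neg_le_abs u))
  rw [semicircleCDF, semicircleLaw, measureReal_def, withDensity_apply _ measurableSet_Iic,
    ← Set.Iic_union_Ioc_eq_Iic hax, lintegral_union measurableSet_Ioc
      (Set.Iic_disjoint_Ioc le_rfl),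
    setLIntegral_congr_fun (g := fun _ => 0) measurableSet_Iic
      (fun u hu => by simp only [h0 u hu, ENNReal.ofReal_zero]),
    lintegral_zero, zero_add, intervalIntegral.integral_of_le hax,
    integral_eq_lintegral_of_nonneg_ae (Eventually.of_forall semicircleDensity_nonneg)
      continuous_semicircleDensity.aestronglyMeasurable]

/-! ### Stieltjes inversion -/

/-- A point `s` of the closed upper half-plane that nearly solves `s² + u s + 1 = 0` has imaginary
part close to `π` times the semicircle density at `u`. The distances of `s` to both roots are at
least `|Im s - π ρ(u)|`, as the roots are real or have imaginary parts `± π ρ(u)`. -/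
lemma sq_im_sub_le {s : ℂ} (hs : 0 ≤ s.im) (u : ℝ) :
    (s.im - Real.pi * semicircleDensity u) ^ 2 ≤ ‖s ^ 2 + u * s + 1‖ := by
  rw [pi_mul_semicircleDensity]
  have key : ∀ r r' : ℂ, r + r' = -u → r * r' = 1 → |s.im - √(4 - u ^ 2) / 2| ≤ |(s - r).im| →
      |s.im - √(4 - u ^ 2) / 2| ≤ |(s - r').im| →
      (s.im - √(4 - u ^ 2) / 2) ^ 2 ≤ ‖s ^ 2 + u * s + 1‖ := by
    intro r r' h1 h2 h3 h4
    have h5 : s ^ 2 + u * s + 1 = (s - r) * (s - r') := by linear_combination s * h1 - h2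
    rw [h5, norm_mul, ← sq_abs, pow_two]
    exact mul_le_mul (h3.trans (Complex.abs_im_le_norm _)) (h4.trans (Complex.abs_im_le_norm _))
      (abs_nonneg _) (norm_nonneg _)
  rcases le_total (u ^ 2) 4 with hu | hu
  · have hy := Real.sq_sqrt (sub_nonneg.2 hu)
    have hy0 := Real.sqrt_nonneg (4 - u ^ 2)
    refine key ⟨-u / 2, √(4 - u ^ 2) / 2⟩ ⟨-u / 2, -(√(4 - u ^ 2) / 2)⟩ ?_ ?_ ?_ ?_
    · apply Complex.ext <;> simp
    · apply Complex.ext <;> simp <;> nlinarith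
    · simp
    · simp only [Complex.sub_im, sub_neg_eq_add]
      rw [abs_of_nonneg (add_nonneg hs (by positivity)), abs_le]
      constructor <;> linarith
  · have hy := Real.sq_sqrt (sub_nonneg.2 hu)
    rw [Real.sqrt_eq_zero_of_nonpos (sub_nonpos.2 hu)] at key ⊢
    refine key ((-u + √(u ^ 2 - 4)) / 2 : ℝ) ((-u - √(u ^ 2 - 4)) / 2 : ℝ) ?_ ?_ ?_ ?_
    · rw [← Complex.ofReal_add, ← Complex.ofReal_neg]; congr 1; ring
    · rw [← Complex.ofReal_mul, ← Complex.ofReal_one]; congr 1; nlinarith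
    · simp
    · simp

/-- `sq_im_sub_le` for a near-solution of the equation at the point `u + i v` off the real axis. -/
lemma sq_im_sub_le_of_im {s : ℂ} (hs : 0 ≤ s.im) {u v K : ℝ} (hv : 0 ≤ v) (hv1 : v ≤ 1)
    (hK : ‖(⟨u, v⟩ : ℂ)‖ ≤ K) :
    (s.im - Real.pi * semicircleDensity u) ^ 2
      ≤ 2 * ‖s ^ 2 + ⟨u, v⟩ * s + 1‖ + v * (3 + K ^ 2) / 2 := by
  set z : ℂ := ⟨u, v⟩ with hz
  set e := s ^ 2 + z * s + 1 with he
  have hzu : z = u + v * Complex.I := by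
    apply Complex.ext <;> simp [hz]
  have h1 : s ^ 2 + u * s + 1 = e - v * Complex.I * s := by rw [he, hzu]; ring
  have h2 : ‖s ^ 2 + u * s + 1‖ ≤ ‖e‖ + v * ‖s‖ := by
    rw [h1]
    refine (norm_sub_le _ _).trans (le_of_eq ?_)
    simp [abs_of_nonneg hv]
  have h3 : ‖s‖ ^ 2 ≤ ‖e‖ + K * ‖s‖ + 1 := by
    have : s ^ 2 = e - z * s - 1 := by rw [he]; ring
    rw [← norm_pow, this]
    refine (norm_sub_le _ _).trans ?_
    rw [norm_one]
    have h4 := norm_sub_le e (z * s)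
    rw [norm_mul] at h4
    have := mul_le_mul_of_nonneg_right hK (norm_nonneg s)
    linarith
  have h5 : ‖s‖ ≤ (3 + 2 * ‖e‖ + K ^ 2) / 2 := by
    nlinarith [sq_nonneg (‖s‖ - 1), sq_nonneg (‖s‖ - K)]
  have h6 : v * ‖s‖ ≤ v * ((3 + 2 * ‖e‖ + K ^ 2) / 2) := mul_le_mul_of_nonneg_left h5 hv
  have h7 : v * ‖e‖ ≤ 1 * ‖e‖ := mul_le_mul_of_nonneg_right hv1 (norm_nonneg _)
  have := sq_im_sub_le hs u
  nlinarith

/-! ### Poisson smoothing of distribution functions -/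

/-- The imaginary part of `1 / (t - (u + i v))`: `π` times the Poisson kernel of width `v`. -/
def poissonKernel (v t u : ℝ) : ℝ := v / ((u - t) ^ 2 + v ^ 2)

section Poisson

variable {v : ℝ}

lemma continuous_poissonKernel (hv : 0 < v) (t : ℝ) : Continuous (poissonKernel v t) :=
  continuous_const.div (by fun_prop) fun u => by positivity

lemma poissonKernel_nonneg (hv : 0 < v) (t u : ℝ) : 0 ≤ poissonKernel v t u := by
  rw [poissonKernel]; positivity

lemma im_inv_sub (t u v : ℝ) : (((t : ℂ) - ⟨u, v⟩)⁻¹).im = poissonKernel v t u := by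
  rw [Complex.inv_im, Complex.normSq_apply, poissonKernel]
  simp only [Complex.sub_im, Complex.ofReal_im, Complex.sub_re, Complex.ofReal_re]
  congr 1 <;> ring

lemma integral_poissonKernel_le (hv : 0 < v) (t α β : ℝ) :
    ∫ u in α..β, poissonKernel v t u ≤ Real.pi := by
  have hd : ∀ u, HasDerivAt (fun u => Real.arctan ((u - t) / v)) (poissonKernel v t u) u := by
    intro u
    have h1 : HasDerivAt (fun u : ℝ => (u - t) / v) (1 / v) u :=
      ((hasDerivAt_id u).sub_const t).div_const v
    convert h1.arctan using 1
    rw [poissonKernel]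
    field_simp
    ring
  rw [intervalIntegral.integral_eq_sub_of_hasDerivAt (fun u _ => hd u)
    ((continuous_poissonKernel hv t).intervalIntegrable _ _)]
  have h1 := Real.arctan_lt_pi_div_two ((β - t) / v)
  have h2 := Real.neg_pi_div_two_lt_arctan ((α - t) / v)
  linarith

lemma integral_poissonKernel_le_of_far (hv : 0 < v) {t α β δ : ℝ} (hαβ : α ≤ β) (hδ : 0 < δ)
    (h : ∀ u ∈ Set.Icc α β, δ ≤ |u - t|) :
    ∫ u in α..β, poissonKernel v t u ≤ (β - α) * (v / δ ^ 2) := by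
  calc ∫ u in α..β, poissonKernel v t u ≤ ∫ _u in α..β, v / δ ^ 2 := by
        refine intervalIntegral.integral_mono_on hαβ
          ((continuous_poissonKernel hv t).intervalIntegrable _ _) (by simp) fun u hu => ?_
        rw [poissonKernel]
        have : δ ^ 2 ≤ (u - t) ^ 2 := by
          rw [← sq_abs (u - t)]; exact pow_le_pow_left₀ hδ.le (h u hu) 2
        gcongr
        nlinarith [sq_nonneg v]
    _ = _ := by simp [mul_div_assoc]

variable {J : Type*} [Fintype J] [Nonempty J]

/-- The proportion of points in a set is bounded below by the smoothed counting measure of an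
interval well inside the set. -/
lemma integral_expect_poissonKernel_le (hv : 0 < v) {α β δ : ℝ} (hαβ : α ≤ β) (hδ : 0 < δ)
    (l : J → ℝ) (S : Set ℝ) [DecidablePred (· ∈ S)]
    (h : ∀ t, t ∉ S → ∀ u ∈ Set.Icc α β, δ ≤ |u - t|) :
    ∫ u in α..β, (1 / Real.pi) * 𝔼 j, poissonKernel v (l j) u
      ≤ 𝔼 j, (if l j ∈ S then (1 : ℝ) else 0) + (β - α) * (v / δ ^ 2) := by
  have hpi := Real.pi_pos
  have h1 : ∫ u in α..β, (1 / Real.pi) * 𝔼 j, poissonKernel v (l j) u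
      = 𝔼 j, (1 / Real.pi) * ∫ u in α..β, poissonKernel v (l j) u := by
    simp only [Fintype.expect_eq_sum_div_card, ← Finset.mul_sum]
    rw [intervalIntegral.integral_const_mul, intervalIntegral.integral_div,
      intervalIntegral.integral_finsetSum fun j _ =>
        (continuous_poissonKernel hv (l j)).intervalIntegrable _ _]
    ring
  rw [h1, ← Fintype.expect_const (ι := J) ((β - α) * (v / δ ^ 2)), ← Finset.expect_add_distrib]
  refine Finset.expect_le_expect fun j _ => ?_
  have hnn : 0 ≤ (β - α) * (v / δ ^ 2) := mul_nonneg (sub_nonneg.2 hαβ) (by positivity)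
  split_ifs with hj
  · have := integral_poissonKernel_le hv (l j) α β
    have : (1 / Real.pi) * ∫ u in α..β, poissonKernel v (l j) u ≤ 1 := by
      rw [one_div, inv_mul_le_iff₀ hpi]; linarith
    linarith
  · have h2 := integral_poissonKernel_le_of_far hv hαβ hδ (h _ hj)
    have h3 : (1 / Real.pi) * ∫ u in α..β, poissonKernel v (l j) u
        ≤ (1 / Real.pi) * ((β - α) * (v / δ ^ 2)) := by gcongr
    have h4 : (1 / Real.pi) ≤ 1 := by
      rw [div_le_one hpi]; linarith [Real.pi_gt_three]
    nlinarith

/-- The distance of an empirical distribution function to the semicircle law is controlled by the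
smoothed densities on an interval to the left and an interval to the right of the point. -/
lemma abs_expect_sub_semicircleCDF_le (hv : 0 < v) {x δ R : ℝ} (hδ : 0 < δ) (hδ1 : δ ≤ 1)
    (hR : |x| + 3 ≤ R) (l : J → ℝ) :
    |𝔼 j, (if l j ≤ x then (1 : ℝ) else 0) - semicircleCDF x|
      ≤ |(∫ u in (-R)..(x - δ), (1 / Real.pi) * 𝔼 j, poissonKernel v (l j) u)
            - ∫ u in (-R)..(x - δ), semicircleDensity u|
        + |(∫ u in (x + δ)..R, (1 / Real.pi) * 𝔼 j, poissonKernel v (l j) u)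
            - ∫ u in (x + δ)..R, semicircleDensity u|
        + δ + 2 * R * (v / δ ^ 2) := by
  have hx := abs_le.1 (le_refl |x|)
  have hi : ∀ c d, IntervalIntegrable semicircleDensity volume c d := fun c d =>
    continuous_semicircleDensity.intervalIntegrable c d
  have h1 := integral_expect_poissonKernel_le hv (α := -R) (β := x - δ) (by linarith) hδ l
    (Set.Iic x) (by
      intro t ht u hu
      rw [Set.mem_Iic, not_le] at ht
      rw [abs_sub_comm]
      exact (by linarith [hu.2] : δ ≤ t - u).trans (le_abs_self _))
  have h2 := integral_expect_poissonKernel_le hv (α := x + δ) (β := R) (by linarith) hδ l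
    (Set.Ioi x) (by
      intro t ht u hu
      rw [Set.mem_Ioi, not_lt] at ht
      exact (by linarith [hu.1] : δ ≤ u - t).trans (le_abs_self _))
  simp only [Set.mem_Iic, Set.mem_Ioi] at h1 h2
  have h3 : 𝔼 j, (if l j ≤ x then (1 : ℝ) else 0) + 𝔼 j, (if x < l j then (1 : ℝ) else 0) = 1 := by
    rw [← Finset.expect_add_distrib, ← Fintype.expect_const (ι := J) (1 : ℝ)]
    refine Finset.expect_congr rfl fun j _ => ?_
    rcases le_or_gt (l j) x with h | h
    · simp [h, h.not_gt]
    · simp [h, h.not_ge]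
  have hsmall : ∀ c d : ℝ, c ≤ d → ∫ u in c..d, semicircleDensity u ≤ d - c := by
    intro c d hcd
    calc ∫ u in c..d, semicircleDensity u ≤ ∫ _u in c..d, (1 : ℝ) :=
          intervalIntegral.integral_mono_on hcd (hi c d) (by simp)
            fun u _ => semicircleDensity_le_one u
      _ = _ := by simp
  have h4 : semicircleCDF x = ∫ u in (-R)..x, semicircleDensity u :=
    semicircleCDF_eq_integral (by linarith [abs_nonneg x]) (by linarith)
  have h5 := intervalIntegral.integral_add_adjacent_intervals (hi (-R) (x - δ)) (hi (x - δ) x)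
  have h6 := intervalIntegral.integral_add_adjacent_intervals (hi (-R) x) (hi x R)
  have h7 := intervalIntegral.integral_add_adjacent_intervals (hi x (x + δ)) (hi (x + δ) R)
  rw [integral_semicircleDensity_eq_one (a := -R) (b := R) (by linarith [abs_nonneg x])
    (by linarith [abs_nonneg x] : (2 : ℝ) ≤ R)] at h6
  have h8 := hsmall (x - δ) x (by linarith)
  have h9 := hsmall x (x + δ) (by linarith)
  have hvd : 0 ≤ v / δ ^ 2 := by positivity
  have h10 : (x - δ - -R) * (v / δ ^ 2) ≤ 2 * R * (v / δ ^ 2) := by gcongr; linarith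
  have h11 : (R - (x + δ)) * (v / δ ^ 2) ≤ 2 * R * (v / δ ^ 2) := by gcongr; linarith
  set J1 := ∫ u in (-R)..(x - δ), (1 / Real.pi) * 𝔼 j, poissonKernel v (l j) u
  set J2 := ∫ u in (x + δ)..R, (1 / Real.pi) * 𝔼 j, poissonKernel v (l j) u
  have a1 := abs_sub_comm J1 (∫ u in (-R)..(x - δ), semicircleDensity u)
  have a2 := abs_sub_comm J2 (∫ u in (x + δ)..R, semicircleDensity u)
  have b1 := le_abs_self ((∫ u in (-R)..(x - δ), semicircleDensity u) - J1)
  have b2 := le_abs_self ((∫ u in (x + δ)..R, semicircleDensity u) - J2)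
  have b3 := abs_nonneg (J1 - ∫ u in (-R)..(x - δ), semicircleDensity u)
  have b4 := abs_nonneg (J2 - ∫ u in (x + δ)..R, semicircleDensity u)
  rw [abs_le]
  constructor <;> linarith

end Poisson

/-- A mean `L¹` bound for random continuous functions, from mean bounds at each point. -/
lemma expect_abs_integral_sub_le {T : Type*} [Fintype T] (f : T → ℝ → ℝ) (g : ℝ → ℝ)
    (hf : ∀ s, Continuous (f s)) (hg : Continuous g) {α β c : ℝ} (hαβ : α ≤ β)
    (h : ∀ u ∈ Set.Icc α β, 𝔼 s, |f s u - g u| ≤ c) :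
    𝔼 s, |(∫ u in α..β, f s u) - ∫ u in α..β, g u| ≤ (β - α) * c := by
  have hcont : ∀ s, Continuous fun u => |f s u - g u| := fun s => ((hf s).sub hg).abs
  calc 𝔼 s, |(∫ u in α..β, f s u) - ∫ u in α..β, g u|
      ≤ 𝔼 s, ∫ u in α..β, |f s u - g u| := by
        refine Finset.expect_le_expect fun s _ => ?_
        rw [← intervalIntegral.integral_sub ((hf s).intervalIntegrable _ _)
          (hg.intervalIntegrable _ _)]
        exact intervalIntegral.abs_integral_le_integral_abs hαβ
    _ = ∫ u in α..β, 𝔼 s, |f s u - g u| := by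
        simp only [Fintype.expect_eq_sum_div_card]
        rw [intervalIntegral.integral_div, intervalIntegral.integral_finsetSum fun s _ =>
          (hcont s).intervalIntegrable _ _]
    _ ≤ ∫ _u in α..β, c := by
        refine intervalIntegral.integral_mono_on hαβ (Continuous.intervalIntegrable ?_ _ _)
          (by simp) h
        simp only [Fintype.expect_eq_sum_div_card]
        exact (continuous_finsetSum _ fun s _ => hcont s).div_const _
    _ = _ := by simp

/-! ### Codes of dual distance at least five -/

section Code

variable {F : Type*} [Field F] {n : ℕ} {C : Submodule F (Fin n → F)}

lemma notMem_dualCode {d : ℕ} (hd : (d + 1 : ℕ) ≤ dualDistance C) {u : Fin n → F} (hu : u ≠ 0)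
    {S : Finset (Fin n)} (hS : ∀ j, j ∉ S → u j = 0) (hcard : S.card ≤ d) : u ∉ dualCode C := by
  classical
  intro hmem
  have h1 : dualDistance C ≤ (hammingNorm u : ℕ∞) := by
    rw [dualDistance]
    convert iInf₂_le (f := fun (u : Fin n → F) (_ : u ∈ {u : Fin n → F | u ∈ dualCode C ∧ u ≠ 0}) =>
      (hammingNorm u : ℕ∞)) u ⟨hmem, hu⟩ using 1
  have h2 : hammingNorm u ≤ S.card := by
    refine Finset.card_le_card fun j hj => ?_
    by_contra h
    simp [hS j h] at hj
  have h3 := hd.trans h1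
  norm_cast at h3
  omega

variable [Finite F]

lemma exists_stdChar_ne_one (F : Type*) [Field F] [Finite F] : ∃ b : F, stdChar F b ≠ 1 := by
  let _ : Algebra (ZMod (ringChar F)) F := ZMod.algebra F (ringChar F)
  obtain ⟨b, hb⟩ := FiniteField.trace_to_zmod_nondegenerate F (a := 1) one_ne_zero
  refine ⟨1 * b, fun h => hb ?_⟩
  refine ZMod.injective_stdAddChar (N := ringChar F) ?_
  rw [AddChar.map_zero_eq_one]
  exact h

/-- Orthogonality of characters on a linear code. -/
lemma sum_stdChar_dotProduct_eq_zero [Fintype C] {u : Fin n → F} (hu : u ∉ dualCode C) :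
    ∑ c : C, stdChar F (u ⬝ᵥ (c : Fin n → F)) = 0 := by
  obtain ⟨c, hc, huc⟩ : ∃ c ∈ C, u ⬝ᵥ c ≠ 0 := by
    by_contra! h
    exact hu h
  obtain ⟨b, hb⟩ := exists_stdChar_ne_one F
  let f : C →+ F :=
    { toFun := fun c => u ⬝ᵥ (c : Fin n → F)
      map_zero' := by simp
      map_add' := fun x y => by simp [dotProduct_add] }
  refine AddChar.sum_eq_zero_of_ne_one (ψ := (stdChar F).compAddMonoidHom f) fun h => hb ?_
  have h1 := DFunLike.congr_fun h ((b / (u ⬝ᵥ c)) • ⟨c, hc⟩ : C)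
  have h2 : f ((b / (u ⬝ᵥ c)) • ⟨c, hc⟩ : C) = b := by
    change u ⬝ᵥ ((b / (u ⬝ᵥ c)) • c) = b
    rw [dotProduct_smul, smul_eq_mul, div_mul_cancel₀ _ huc]
  rwa [AddChar.compAddMonoidHom_apply, h2, AddChar.one_apply] at h1

lemma star_stdChar (a : F) : star (stdChar F a) = stdChar F (-a) :=
  (AddChar.map_neg_eq_conj _ _).symm

/-- A uniformly random codeword of a code of dual distance at least five has, after applying the
character to its coordinates, fourwise orthogonal coordinates. -/
lemma fourwiseOrthogonal_eps [Fintype C] (hC : 5 ≤ dualDistance C) :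
    FourwiseOrthogonal fun c : C => eps (c : Fin n → F) where
  norm_eq_one c j := AddChar.norm_apply _ _
  expect_pair j k hjk := by
    have hu : (Pi.single j 1 - Pi.single k 1 : Fin n → F) ∉ dualCode C := by
      refine notMem_dualCode (d := 4) hC (fun h => ?_) (S := {j, k}) (fun l hl => ?_)
        (Finset.card_le_two.trans (by norm_num))
      · simpa [hjk] using congrFun h j
      · simp only [Finset.mem_insert, Finset.mem_singleton, not_or] at hl
        simp [hl.1, hl.2]
    rw [Fintype.expect_eq_sum_div_card, ← zero_div (Fintype.card C : ℂ),
      ← sum_stdChar_dotProduct_eq_zero hu]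
    congr 1
    refine Finset.sum_congr rfl fun c _ => ?_
    simp only [eps, star_stdChar, sub_dotProduct, single_one_dotProduct]
    rw [sub_eq_add_neg, AddChar.map_add_eq_mul]
  expect_quad j k l m hjk hlm h1 h2 := by
    have hu : (Pi.single j 1 - Pi.single k 1 - (Pi.single l 1 - Pi.single m 1) : Fin n → F)
        ∉ dualCode C := by
      refine notMem_dualCode (d := 4) hC (fun h => ?_) (S := {j, k, l, m}) (fun i hi => ?_)
        Finset.card_le_four
      · have hj := congrFun h j
        have hk := congrFun h k
        simp only [Pi.sub_apply, Pi.single_apply, Pi.zero_apply] at hj hk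
        -- an unpaired index carries the coefficient `± 1`
        by_cases hl : j = l <;> by_cases hm : j = m <;> by_cases hkl : k = l <;>
          by_cases hkm : k = m <;> simp_all [eq_comm]
      · simp only [Finset.mem_insert, Finset.mem_singleton, not_or] at hi
        simp [hi.1, hi.2.1, hi.2.2.1, hi.2.2.2]
    rw [Fintype.expect_eq_sum_div_card, ← zero_div (Fintype.card C : ℂ),
      ← sum_stdChar_dotProduct_eq_zero hu]
    congr 1
    refine Finset.sum_congr rfl fun c _ => ?_
    simp only [eps, star_mul', star_stdChar, sub_dotProduct, single_one_dotProduct]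
    simp only [sub_eq_add_neg, AddChar.map_add_eq_mul, neg_add, neg_neg]

/-- A code of length `n` and dual distance at least five has at least `(n - 1)² / 2` codewords:
the squared modulus of the coordinate sum has mean `n` and variance at most `2 n²`, but takes the
value `n²` at the zero codeword. -/
lemma sq_le_two_mul_card [Fintype C] (hC : 5 ≤ dualDistance C) (hn : 0 < n) :
    ((n : ℝ) - 1) ^ 2 ≤ 2 * Fintype.card C := by
  have hn' : (0 : ℝ) < n := by exact_mod_cast hn
  have hcard : (0 : ℝ) < Fintype.card C := by exact_mod_cast Fintype.card_pos
  have h := (fourwiseOrthogonal_eps hC).expect_norm_quadForm_sub_sq_le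
    (Matrix.of fun _ _ => (1 : ℂ))
  have h1 : ∑ _j : Fin n, ∑ _k : Fin n, ‖(Matrix.of fun _ _ : Fin n => (1 : ℂ)) _j _k‖ ^ 2
      = (n : ℝ) ^ 2 := by simp [pow_two]
  rw [h1, Fintype.expect_eq_sum_div_card, div_le_iff₀ hcard] at h
  have h2 := (Finset.single_le_sum (f := fun c : C =>
    ‖eps (c : Fin n → F) ⬝ᵥ ((Matrix.of fun _ _ => (1 : ℂ)) *ᵥ star (eps (c : Fin n → F)))
      - (Matrix.of fun _ _ : Fin n => (1 : ℂ)).trace‖ ^ 2) (fun _ _ => sq_nonneg _)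
      (Finset.mem_univ 0)).trans h
  have h3 : (eps ((0 : C) : Fin n → F)) = fun _ => (1 : ℂ) := by
    ext j; simp [eps]
  have h4 : ‖eps ((0 : C) : Fin n → F) ⬝ᵥ ((Matrix.of fun _ _ => (1 : ℂ)) *ᵥ
      star (eps ((0 : C) : Fin n → F))) - (Matrix.of fun _ _ : Fin n => (1 : ℂ)).trace‖ ^ 2
      = (n : ℝ) ^ 2 * ((n : ℝ) - 1) ^ 2 := by
    rw [h3]
    have : (fun _ => (1 : ℂ)) ⬝ᵥ ((Matrix.of fun _ _ : Fin n => (1 : ℂ)) *ᵥ star (fun _ => (1 : ℂ)))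
        - (Matrix.of fun _ _ : Fin n => (1 : ℂ)).trace = (((n : ℝ) * ((n : ℝ) - 1) : ℝ) : ℂ) := by
      simp [dotProduct, Matrix.mulVec, Matrix.trace]
      ring
    rw [this, Complex.norm_real, Real.norm_eq_abs, sq_abs]
    ring
  rw [h4] at h2
  have h5 : (0 : ℝ) < (n : ℝ) ^ 2 := by positivity
  nlinarith

end Code

/-! ### Convergence for independent rows -/

section Mean

variable {Ω ι κ : Type*} [Fintype Ω] [Nonempty Ω] [Fintype ι] [DecidableEq ι] [Fintype κ]

lemma im_stieltjes (V : Matrix ι κ ℂ) {u v : ℝ} (hv : 0 < v) :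
    (stieltjes V ⟨u, v⟩).im
      = 𝔼 j, poissonKernel v ((crossGram_isHermitian V).eigenvalues j) u := by
  rw [stieltjes, trace_resolvent (crossGram_isHermitian V) hv.ne', Fintype.expect_eq_sum_div_card,
    ← Complex.ofReal_natCast, ← Complex.ofReal_inv, Complex.im_ofReal_mul, Complex.im_sum,
    div_eq_inv_mul]
  simp only [im_inv_sub]

/-- The bound for the mean distance to the semicircle law at one point, with smoothing at the
scale `v` and a margin of length `δ`. -/
def cdfErrorBound (p t δ v R : ℝ) : ℝ :=
  4 * R * √(2 * meanErrorBound p t v (R + 1) + v * (3 + (R + 1) ^ 2) / 2) + δ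
    + 2 * R * (v / δ ^ 2)

lemma expect_abs_sub_semicircleCDF_le [Nonempty ι] [DecidableEq κ] [Nonempty κ] {X : Ω → κ → ℂ}
    (hX : FourwiseOrthogonal X) {x δ v R : ℝ} (hv : 0 < v) (hv1 : v ≤ 1) (hδ : 0 < δ)
    (hδ1 : δ ≤ 1) (hR : |x| + 3 ≤ R) :
    𝔼 s : ι → Ω, |𝔼 j, (if (crossGram_isHermitian
        (Matrix.of fun b => X (s b))).eigenvalues j ≤ x then (1 : ℝ) else 0) - semicircleCDF x|
      ≤ cdfErrorBound (Fintype.card ι) (gramScale ι κ) δ v R := by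
  set W : (ι → Ω) → Matrix ι κ ℂ := fun s => Matrix.of fun b => X (s b) with hW
  set l : (ι → Ω) → ι → ℝ := fun s => (crossGram_isHermitian (W s)).eigenvalues with hl
  set c := √(2 * meanErrorBound (Fintype.card ι) (gramScale ι κ) v (R + 1)
    + v * (3 + (R + 1) ^ 2) / 2) with hc
  have hpi := Real.pi_pos
  have hx := abs_le.1 (le_refl |x|)
  have hpt : ∀ u ∈ Set.Icc (-R) R,
      𝔼 s, |(1 / Real.pi) * 𝔼 j, poissonKernel v (l s j) u - semicircleDensity u| ≤ c := by
    intro u hu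
    have hK : ‖(⟨u, v⟩ : ℂ)‖ ≤ R + 1 := by
      refine (Complex.norm_le_abs_re_add_abs_im _).trans ?_
      rw [abs_of_pos hv]
      exact add_le_add (abs_le.2 hu) hv1
    refine expect_le_sqrt ?_
    calc 𝔼 s, |(1 / Real.pi) * 𝔼 j, poissonKernel v (l s j) u - semicircleDensity u| ^ 2
        ≤ 𝔼 s, (2 * ‖stieltjes (W s) ⟨u, v⟩ ^ 2 + ⟨u, v⟩ * stieltjes (W s) ⟨u, v⟩ + 1‖
            + v * (3 + (R + 1) ^ 2) / 2) := by
          refine Finset.expect_le_expect fun s _ => ?_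
          have him := im_stieltjes (W s) (u := u) hv
          have hnn : 0 ≤ (stieltjes (W s) ⟨u, v⟩).im := by
            rw [him]; exact Finset.expect_nonneg fun j _ => poissonKernel_nonneg hv _ _
          refine le_trans ?_ (sq_im_sub_le_of_im hnn hv.le hv1 hK)
          rw [sq_abs, ← him]
          have e : (1 / Real.pi) * (stieltjes (W s) ⟨u, v⟩).im - semicircleDensity u
              = ((stieltjes (W s) ⟨u, v⟩).im - Real.pi * semicircleDensity u) / Real.pi := by
            field_simp
          rw [e, div_pow]
          exact div_le_self (sq_nonneg _) (one_le_pow₀ (by linarith [Real.pi_gt_three]))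
      _ ≤ _ := by
          rw [Finset.expect_add_distrib, Fintype.expect_const, ← Finset.mul_expect]
          gcongr
          exact expect_norm_stieltjes_sq_add_le hX (z := ⟨u, v⟩) hv hK
  have hcont : ∀ s, Continuous fun u => (1 / Real.pi) * 𝔼 j, poissonKernel v (l s j) u := by
    intro s
    simp only [Fintype.expect_eq_sum_div_card]
    exact continuous_const.mul
      ((continuous_finsetSum _ fun j _ => continuous_poissonKernel hv _).div_const _)
  have h1 := expect_abs_integral_sub_le _ _ hcont continuous_semicircleDensity
    (α := -R) (β := x - δ) (by linarith) fun u hu => hpt u ⟨hu.1, by linarith [hu.2]⟩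
  have h2 := expect_abs_integral_sub_le _ _ hcont continuous_semicircleDensity
    (α := x + δ) (β := R) (by linarith) fun u hu => hpt u ⟨by linarith [hu.1], hu.2⟩
  refine (Finset.expect_le_expect fun s _ =>
    abs_expect_sub_semicircleCDF_le hv hδ hδ1 hR (l s)).trans ?_
  rw [Finset.expect_add_distrib, Finset.expect_add_distrib, Finset.expect_add_distrib,
    Fintype.expect_const, Fintype.expect_const, cdfErrorBound, ← hc]
  have h3 : (x - δ - -R) * c ≤ 2 * R * c := by gcongr; linarith
  have h4 : (R - (x + δ)) * c ≤ 2 * R * c := by gcongr; linarith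
  linarith

end Mean

lemma tendsto_meanErrorBound {p t : ℕ → ℝ} (hp : Tendsto p atTop atTop)
    (hpt : Tendsto (fun i => p i / t i) atTop (𝓝 0)) (η K : ℝ) :
    Tendsto (fun i => meanErrorBound (p i) (t i) η K) atTop (𝓝 0) := by
  have hinv : Tendsto (fun i => (p i)⁻¹) atTop (𝓝 0) := tendsto_inv_atTop_zero.comp hp
  have hcont : Continuous fun y : ℝ × ℝ => 1 / η * (2 * (y.1 * (η ^ 2)⁻¹) + (y.1 * η⁻¹
      + y.2 * (1 + K / η)) + √(2 * (3 * y.1 * (1 / η ^ 2 + y.2 ^ 2 * (1 + K ^ 2 / η ^ 2))))) := by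
    fun_prop
  have h := (hcont.tendsto (0, 0)).comp (hinv.prodMk_nhds hpt)
  simp only [zero_mul, mul_zero, add_zero, Real.sqrt_zero] at h
  refine h.congr fun i => ?_
  simp only [Function.comp_apply, meanErrorBound, schurFormBound, div_eq_mul_inv, mul_inv, one_mul]

/-- The error bound can be made arbitrarily small by choosing the margin, then the scale of
smoothing, and then the dimensions. -/
lemma exists_cdfErrorBound_lt {p t : ℕ → ℝ} (hp : Tendsto p atTop atTop)
    (hpt : Tendsto (fun i => p i / t i) atTop (𝓝 0)) (R : ℝ) {ε : ℝ} (hε : 0 < ε) :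
    ∃ δ v : ℝ, 0 < δ ∧ δ ≤ 1 ∧ 0 < v ∧ v ≤ 1 ∧
      ∀ᶠ i in atTop, cdfErrorBound (p i) (t i) δ v R < ε := by
  set δ := min 1 (ε / 2) with hδ
  have hδ0 : 0 < δ := by positivity
  have hδε : δ < ε := (min_le_right _ _).trans_lt (by linarith)
  have hcont : Continuous fun v : ℝ =>
      4 * R * √(v * (3 + (R + 1) ^ 2) / 2) + δ + 2 * R * (v / δ ^ 2) := by fun_prop
  have h0 := hcont.tendsto 0
  simp only [zero_mul, zero_div, Real.sqrt_zero, mul_zero, zero_add, add_zero] at h0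
  have h1 := (h0.mono_left (nhdsWithin_le_nhds (s := Set.Ioi 0))).eventually (gt_mem_nhds hδε)
  obtain ⟨v, hvε, hv0, hv1⟩ := (h1.and (Ioc_mem_nhdsGT (zero_lt_one' ℝ))).exists
  refine ⟨δ, v, hδ0, min_le_left _ _, hv0, hv1, ?_⟩
  have hcont2 : Continuous fun e : ℝ =>
      4 * R * √(2 * e + v * (3 + (R + 1) ^ 2) / 2) + δ + 2 * R * (v / δ ^ 2) := by fun_prop
  have h2 := (hcont2.tendsto 0).comp (tendsto_meanErrorBound hp hpt v (R + 1))
  simp only [mul_zero, zero_add] at h2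
  exact h2.eventually (gt_mem_nhds hvε)

/-! ### From independent to distinct codewords -/

lemma empiricalSpectralDistribution_eq {p : ℕ} {A : Matrix (Fin p) (Fin p) ℂ}
    (hA : A.IsHermitian) (x : ℝ) :
    empiricalSpectralDistribution hA x
      = 𝔼 j, (if hA.eigenvalues j ≤ x then (1 : ℝ) else 0) := by
  rw [empiricalSpectralDistribution, spectralMeasure, measureReal_def, Measure.smul_apply,
    Measure.finsetSum_apply, smul_eq_mul, ENNReal.toReal_mul, ENNReal.toReal_inv,
    ENNReal.toReal_natCast, ENNReal.toReal_sum (fun j _ => measure_ne_top _ _),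
    Fintype.expect_eq_sum_div_card, Fintype.card_fin, div_eq_inv_mul]
  congr 1
  refine Finset.sum_congr rfl fun j _ => ?_
  rw [Measure.dirac_apply' _ measurableSet_Iic, Set.indicator_apply]
  simp only [Set.mem_Iic]
  split_ifs <;> simp

lemma normalizedGram_eq_crossGram {F : Type*} [Field F] [Finite F] {n p : ℕ}
    {C : Submodule F (Fin n → F)} (hn : 0 < n) (s : Fin p ↪ C) :
    normalizedGram s = crossGram (Matrix.of fun a => eps (s a : Fin n → F)) := by
  have hn' : (n : ℂ) ≠ 0 := by exact_mod_cast hn.ne'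
  ext a b
  have hp : (0 : ℝ) < p := by exact_mod_cast (Fin.pos a)
  have hnr : (0 : ℝ) < n := by exact_mod_cast hn
  simp only [normalizedGram, gram, codeMatrix, crossGram, Matrix.smul_apply, Matrix.sub_apply,
    Matrix.of_apply, smul_eq_mul]
  set Φ : Matrix (Fin p) (Fin n) ℂ := Matrix.of fun a => eps (s a : Fin n → F) with hΦ
  rcases eq_or_ne a b with rfl | hab
  · have h1 : ∀ j, Φ a j * star (Φ a j) = 1 := by
      intro j
      have h2 : ‖Φ a j‖ = 1 := AddChar.norm_apply (stdChar F) _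
      have := Complex.mul_conj (Φ a j)
      rw [Complex.normSq_eq_norm_sq, h2] at this
      simpa using this
    simp only [Matrix.mul_apply, Matrix.conjTranspose_apply, h1]
    simp [hn']
  · have h3 : √((n : ℝ) / p) * (1 / n) = 1 / gramScale (Fin p) (Fin n) := by
      rw [gramScale, Fintype.card_fin, Fintype.card_fin, Real.sqrt_div hnr.le,
        Real.sqrt_mul hp.le]
      have := Real.sq_sqrt hnr.le
      have h4 := Real.sqrt_pos.2 hp
      have h5 := Real.sqrt_pos.2 hnr
      field_simp
      exact this
    have h4 := congrArg Complex.ofReal h3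
    push_cast at h4
    rw [Matrix.one_apply_ne hab, if_neg hab, sub_zero, ← mul_assoc, h4]
    ring

/-- The empirical spectral distribution for a tuple of codewords that need not be distinct. -/
def tupleSpectralDistribution {F : Type*} [Field F] [Finite F] {n p : ℕ}
    {C : Submodule F (Fin n → F)} (s : Fin p → C) (x : ℝ) : ℝ :=
  𝔼 j, (if (crossGram_isHermitian
    (Matrix.of fun a => eps (s a : Fin n → F))).eigenvalues j ≤ x then (1 : ℝ) else 0)

lemma empiricalSpectralDistribution_normalizedGram {F : Type*} [Field F] [Finite F] {n p : ℕ}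
    {C : Submodule F (Fin n → F)} (hn : 0 < n) (s : Fin p ↪ C) (x : ℝ) :
    empiricalSpectralDistribution (normalizedGram_isHermitian s) x
      = tupleSpectralDistribution (s : Fin p → C) x := by
  rw [tupleSpectralDistribution, ← empiricalSpectralDistribution_eq]
  congr 1
  exact normalizedGram_eq_crossGram hn s

/-- Among the maps into a large set, the injective ones are at least half. -/
lemma pow_le_two_mul_descFactorial {N p : ℕ} (h : 2 * p ^ 2 ≤ N) :
    (N : ℝ) ^ p ≤ 2 * N.descFactorial p := by
  rcases Nat.eq_zero_or_pos p with rfl | hp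
  · simp
  have hpN : p ≤ N := by nlinarith
  have hN : (0 : ℝ) < N := by exact_mod_cast hp.trans_le hpN
  have h1 : ((N + 1 - p : ℕ) : ℝ) ^ p ≤ N.descFactorial p := by
    exact_mod_cast Nat.pow_sub_le_descFactorial N p
  have h2 : (N : ℝ) - p ≤ (N + 1 - p : ℕ) := by
    rw [Nat.cast_sub (by omega)]; push_cast; linarith
  have hpN' : (p : ℝ) ≤ N := by exact_mod_cast hpN
  have h3 : ((N : ℝ) - p) ^ p ≤ ((N + 1 - p : ℕ) : ℝ) ^ p :=
    pow_le_pow_left₀ (by linarith) h2 p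
  have h4 : 1 + (p : ℝ) * (-(p / N)) ≤ (1 + -((p : ℝ) / N)) ^ p := by
    refine one_add_mul_le_pow ?_ p
    have : (p : ℝ) / N ≤ 1 := (div_le_one hN).2 hpN'
    linarith
  have h5 : ((N : ℝ) - p) ^ p = N ^ p * (1 + -((p : ℝ) / N)) ^ p := by
    rw [← mul_pow]; congr 1; field_simp; ring
  have h6 : (p : ℝ) * (p / N) ≤ 1 / 2 := by
    have : (2 * p ^ 2 : ℝ) ≤ N := by exact_mod_cast h
    rw [← mul_div_assoc, div_le_iff₀ hN]
    nlinarith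
  have h7 : (0 : ℝ) < N ^ p := by positivity
  nlinarith

/-- A Markov bound for distinct codewords, from a mean over all tuples of codewords. -/
lemma distinctCodewordsMeasure_le {F : Type*} [Field F] [Finite F] {n p : ℕ}
    (C : Submodule F (Fin n → F)) [Fintype C] (hp : 2 * p ^ 2 ≤ Fintype.card C)
    (f : (Fin p → C) → ℝ) (hf : ∀ s, 0 ≤ f s) {δ : ℝ} (hδ : 0 < δ) :
    distinctCodewordsMeasure C p {s | δ ≤ f s} ≤ ENNReal.ofReal (2 * (𝔼 s, f s) / δ) := by
  classical
  set N := Fintype.card C with hN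
  have hNpos : 0 < N := Fintype.card_pos
  have hpow := pow_le_two_mul_descFactorial hp
  have hD : (0 : ℝ) < N.descFactorial p := by
    have : (0 : ℝ) < (N : ℝ) ^ p := by positivity
    linarith
  set T : Finset (Fin p ↪ C) := Finset.univ.filter fun s => δ ≤ f s with hT
  have hS : {s : Fin p ↪ C | δ ≤ f s} = (T : Set (Fin p ↪ C)) := by ext; simp [hT]
  have hmeas : distinctCodewordsMeasure C p {s | δ ≤ f s}
      = (T.card : ℝ≥0∞) / (N.descFactorial p : ℝ≥0∞) := by
    let _ : MeasurableSpace (Fin p ↪ C) := ⊤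
    rw [distinctCodewordsMeasure, hS, ProbabilityTheory.uniformOn_univ,
      Measure.count_apply_finset' (s := T) trivial, Fintype.card_embedding_eq, Fintype.card_fin]
  have hmarkov : (T.card : ℝ) * δ ≤ (N : ℝ) ^ p * 𝔼 s, f s := by
    calc (T.card : ℝ) * δ = ∑ _s ∈ T, δ := by simp
      _ ≤ ∑ s ∈ T, f s := Finset.sum_le_sum fun s hs => (Finset.mem_filter.1 hs).2
      _ ≤ ∑ s : Fin p ↪ C, f s :=
          Finset.sum_le_sum_of_subset_of_nonneg (Finset.subset_univ _) fun _ _ _ => hf _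
      _ = ∑ s ∈ Finset.univ.map ⟨fun s : Fin p ↪ C => (s : Fin p → C), DFunLike.coe_injective⟩,
            f s := by rw [Finset.sum_map]; rfl
      _ ≤ ∑ s, f s :=
          Finset.sum_le_sum_of_subset_of_nonneg (Finset.subset_univ _) fun _ _ _ => hf _
      _ = _ := by
          rw [← Fintype.card_mul_expect]
          simp [hN]
  have hE : 0 ≤ 𝔼 s, f s := Finset.expect_nonneg fun s _ => hf s
  rw [hmeas, ← ENNReal.ofReal_natCast, ← ENNReal.ofReal_natCast (N.descFactorial p),
    ← ENNReal.ofReal_div_of_pos hD]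
  refine ENNReal.ofReal_le_ofReal ?_
  rw [div_le_div_iff₀ hD hδ]
  calc (T.card : ℝ) * δ ≤ (N : ℝ) ^ p * 𝔼 s, f s := hmarkov
    _ ≤ 2 * N.descFactorial p * 𝔼 s, f s := by gcongr
    _ = _ := by ring

end CodeSC

end

theorem theorem2 {F : Type*} [Field F] [Finite F]
    (n p : ℕ → ℕ) (C : (i : ℕ) → Submodule F (Fin (n i) → F))
    (hN : Tendsto (fun i => (Nat.card (C i) : ℝ) / (n i : ℝ)) atTop atTop)
    (hdual : ∀ i, 5 ≤ CodeSC.dualDistance (C i))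
    (c : ℝ) (hc : 0 < c)
    (hinner : ∀ i, ∀ v ∈ CodeSC.eps '' (C i : Set (Fin (n i) → F)),
      ∀ v' ∈ CodeSC.eps '' (C i : Set (Fin (n i) → F)), v ≠ v' →
        ‖v ⬝ᵥ star v'‖ ≤ c * Real.sqrt (n i))
    (hn : Tendsto n atTop atTop) (hp : Tendsto p atTop atTop)
    (hnp : Tendsto (fun i => (n i : ℝ) / (p i : ℝ)) atTop atTop) (x : ℝ) :
    ∀ δ : ℝ, 0 < δ → Tendsto
      (fun i => CodeSC.distinctCodewordsMeasure (C i) (p i)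
        {s | δ ≤ |CodeSC.empiricalSpectralDistribution (CodeSC.normalizedGram_isHermitian s) x
          - CodeSC.semicircleCDF x|})
      atTop (𝓝 0) := by
  intro δ hδ
  let _ : ∀ i, Fintype (C i) := fun i => Fintype.ofFinite _
  rw [ENNReal.tendsto_nhds_zero]
  intro ε hε
  obtain ⟨ε', hε'0, hε'⟩ : ∃ ε' : ℝ, 0 < ε' ∧ ENNReal.ofReal ε' ≤ ε := by
    rcases eq_or_ne ε ⊤ with rfl | h
    · exact ⟨1, one_pos, le_top⟩
    · exact ⟨ε.toReal, ENNReal.toReal_pos hε.ne' h, (ENNReal.ofReal_toReal h).le⟩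
  have hpR : Tendsto (fun i => (p i : ℝ)) atTop atTop := tendsto_natCast_atTop_atTop.comp hp
  have hratio : Tendsto
      (fun i => (p i : ℝ) / CodeSC.gramScale (Fin (p i)) (Fin (n i))) atTop (𝓝 0) := by
    have h1 : Tendsto (fun i => √(((n i : ℝ) / p i)⁻¹)) atTop (𝓝 0) := by
      have := (Real.continuous_sqrt.tendsto 0).comp (tendsto_inv_atTop_zero.comp hnp)
      rwa [Real.sqrt_zero] at this
    refine h1.congr fun i => ?_
    rw [CodeSC.gramScale, Fintype.card_fin, Fintype.card_fin, inv_div, Real.sqrt_div' _ (by simp),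
      Real.sqrt_mul (by simp)]
    rcases (p i).eq_zero_or_pos with h | h
    · simp [h]
    · have hs : 0 < √(p i : ℝ) := Real.sqrt_pos.2 (by exact_mod_cast h)
      rw [← div_div]
      congr 1
      rw [eq_div_iff hs.ne']
      exact Real.mul_self_sqrt (by simp)
  obtain ⟨δ', v, hδ'0, hδ'1, hv0, hv1, hev⟩ := CodeSC.exists_cdfErrorBound_lt hpR hratio (|x| + 3)
    (ε := ε' * δ / 2) (by positivity)
  filter_upwards [hev, hp.eventually_ge_atTop 1, hn.eventually_ge_atTop 1,
    hnp.eventually_ge_atTop 3] with i hi hpi hni hnpi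
  have hp0 : (0 : ℝ) < p i := by exact_mod_cast hpi
  have : Nonempty (Fin (p i)) := ⟨⟨0, hpi⟩⟩
  have : Nonempty (Fin (n i)) := ⟨⟨0, hni⟩⟩
  have hX := CodeSC.fourwiseOrthogonal_eps (hdual i)
  -- `(n - 1)² / 2 ≤ |C|` and `n ≥ 3 p` make collisions among `p` random codewords rare
  have hcard : 2 * p i ^ 2 ≤ Fintype.card (C i) := by
    have h1 := CodeSC.sq_le_two_mul_card (hdual i) hni
    rw [le_div_iff₀ hp0] at hnpi
    have h2 : (1 : ℝ) ≤ p i := by exact_mod_cast hpi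
    have h3 : (2 * p i : ℝ) ^ 2 ≤ ((n i : ℝ) - 1) ^ 2 :=
      pow_le_pow_left₀ (by positivity) (by linarith) 2
    have h4 : (2 * p i ^ 2 : ℝ) ≤ Fintype.card (C i) := by nlinarith
    exact_mod_cast h4
  have hmean := CodeSC.expect_abs_sub_semicircleCDF_le (ι := Fin (p i)) hX (x := x) hv0 hv1 hδ'0
    hδ'1 le_rfl
  rw [Fintype.card_fin] at hmean
  refine le_trans ?_ hε'
  simp only [CodeSC.empiricalSpectralDistribution_normalizedGram hni]
  refine (CodeSC.distinctCodewordsMeasure_le (C i) hcard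
    (fun s => |CodeSC.tupleSpectralDistribution s x - CodeSC.semicircleCDF x|)
    (fun s => abs_nonneg _) hδ).trans ?_
  refine ENNReal.ofReal_le_ofReal ?_
  have hmean' := (show Finset.expect Finset.univ (fun s : Fin (p i) → C i =>
    |CodeSC.tupleSpectralDistribution s x - CodeSC.semicircleCDF x|) ≤ _ from hmean).trans hi.le
  rw [div_le_iff₀ hδ]
  linarith
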